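/- **Corollary (Optimal policies).** Let $A\in\mathbb R^{n\times n}$, $B\in\mathbb R^{n\times m}$, let $Q\in\mathbb R^{n\times n}$ be symmetric positive semidefinite and $\gamma\in(0,1)$. Assume that $(A,B)$ is stabilizable, $(A,Q^{1/2})$ is detectable (i.e. $A+BK$, respectively $A+LQ^{1/2}$, has spectral radius $<1$ for some matrix $K$, respectively $L$), and $B$ has full column rank. For $\Sigma_w$ symmetric positive definite and $\Sigma_0$ symmetric positive semidefinite consider $$x_{t+1}=Ax_t+Bu_t+w_t,\quad t\in\mathbb N,\qquad u_t=Fx_t,\quad F\in\mathbb R^{m\times n},$$ with $x_0\sim\mathcal N(0,\Sigma_0)$, $w_t$ i.i.d. $\sim\mathcal N(0,\Sigma_w)$, and $x_0$ independent of $(w_t)_t$. Put $p_t=\mathcal N(Ax_t+Bu_t,\Sigma_w)$, $p_t^0=\mathcal N(Ax_t,\Sigma_w)$ and, for $\circ\in\{\mathrm{KL},\mathrm{WKL},\mathrm{KW}\}$ and a parameter $\lambda>0$, $$J^\circ(F)=\mathbb E\Big[\sum_{t=0}^\infty\gamma^t\big(\tfrac12x_t^{\top}Qx_t+D^\circ(p_t\mid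 p_t^0)\big)\Big]\in[0,\infty].$$ Here $D^{\mathrm{KL}}$ is the Kullback–Leibler divergence. $D^{\mathrm{WKL}}$ and $D^{\mathrm{KW}}$ are defined with $C(\mu)=I$ and $C(\mu)=\operatorname{Cov}(\mu)+\lambda I$, respectively: $D(\mu\mid\nu)$ is the infimum of $\int_0^1t\int\langle\nabla f,C(\mu_t)\nabla f\rangle\,d\mu_t\,dt$ over all curves $(\mu_t)_{t\in[0,1]}$ of nondegenerate Gaussian measures with $\mu_0=\mu$, $\mu_1=\nu$ and all time-independent quadratic potentials $f(x)=\frac12x^\top Sx+b^\top x$ ($S$ symmetric) such that $\partial_t\mu_t=-\nabla\cdot(\mu_tC(\mu_t)\nabla f)$ holds weakly on $[0,1]$, tested against bounded smooth functions with bounded gradient. Let $$R_{\mathrm{KL}}=B^\top\Sigma_w^{-1}B,\qquad R_{\mathrm{WKL}}=B^\top B,\qquad R_{\mathrm{KW}}=B^\top(\Sigma_w+\lambda I)^{-1}B .$$ Then, for each $\circ$, all $\Sigma_w\succ0$, $\Sigma_0\succeq0$ and all $\lambda>0$: * The Riccati equation $$A_\gamma^\top PA_\gamma-P+Q-A_\gamma^\top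 PB\,(B^\top PB+\gamma^{-1}R_\circ)^{-1}B^\top PA_\gamma=0,\qquad A_\gamma=\sqrt\gamma A,$$ has exactly one symmetric positive semidefinite solution $P_\circ$; if $Q$ is positive definite, so is $P_\circ$. * The gain $$F_\circ=-\gamma\,(R_\circ+\gamma B^\top P_\circ B)^{-1}B^\top P_\circ A$$ has finite cost and is the unique minimizer of $J^\circ$ over all $F\in\mathbb R^{m\times n}$: $J^\circ(F_\circ)<J^\circ(F)$ for every $F\ne F_\circ$. The gain $F_{\mathrm{WKL}}$ does not depend on $\Sigma_w$. If $\Sigma_w=\rho I$ with $\rho>0$ and $\lambda=1$, then 1. $\lim_{\rho\searrow0}F_{\mathrm{KW}}=F_{\mathrm{WKL}}$. 2. $\lim_{\rho\to\infty}\|F_{\mathrm{KW}}-F_{\mathrm{KL}}\|=0$. 3. If moreover the spectral radius of $A$ is less than $1/\sqrt\gamma$, then $\lim_{\rho\searrow0}F_{\mathrm{KL}}=0$, while $\lim_{\rho\searrow0}F_{\mathrm{KW}}=F_{\mathrm{WKL}}$ is not the zero gain in general: for every $\gamma\in(0,1)$ there is a system, with $Q$ positive definite, satisfying all the hypotheses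 (including this one) for which $F_{\mathrm{WKL}}\ne0$. -/

import Mathlib

open MeasureTheory ProbabilityTheory InformationTheory Filter Topology
open scoped Matrix MatrixOrder ENNReal

noncomputable section

namespace RegularizedLQR

/-! ### Euclidean state spaces -/

/-- `ℝⁿ` with the Euclidean norm. -/
abbrev Euc (n : ℕ) : Type := EuclideanSpace ℝ (Fin n)

/-- The matrix-vector product `M x`, with `x` and `M x` in Euclidean spaces. -/
def act {n m : ℕ} (M : Matrix (Fin n) (Fin m) ℝ) (x : Euc m) : Euc n :=
  Matrix.toEuclideanLin M x

/-! ### Wasserstein-type divergences between Gaussian measures -/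

/-- The covariance matrix of a measure on `ℝⁿ`. -/
def covMatrix {n : ℕ} (μ : Measure (Euc n)) : Matrix (Fin n) (Fin n) ℝ :=
  Matrix.of fun i j => cov[fun x : Euc n => x i, fun x : Euc n => x j; μ]

/-- A transport geometry on measures over `ℝⁿ`, given by its matrix-valued mobility `C(μ)`.  The
inertia operator is `φ_μ([f]) = -∇·(μ C(μ) ∇f)` and the cotangent inner product is
`⟨⟨[f], [g]⟩⟩_μ = ∫ ⟨∇f, C(μ) ∇g⟩ dμ`. -/
abbrev Mobility (n : ℕ) : Type := Measure (Euc n) → Matrix (Fin n) (Fin n) ℝ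

/-- Otto's Wasserstein geometry: `C(μ) = I`. -/
def ottoMobility (n : ℕ) : Mobility n := fun _ => 1

/-- The Kalman-Wasserstein geometry with parameter `lam`: `C(μ) = Cov(μ) + lam I`. -/
def kalmanMobility (n : ℕ) (lam : ℝ) : Mobility n := fun μ => covMatrix μ + lam • 1

/-- The velocity field `C(μ) ∇f` driving the dual geodesic with potential `f`. -/
def velocity {n : ℕ} (C : Mobility n) (f : Euc n → ℝ) (μ : Measure (Euc n)) (x : Euc n) : Euc n :=
  act (C μ) (gradient f x)

/-- The curve `c` of measures on the time interval `[0, 1]` is the dual geodesic with the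
time-independent potential `f`: it solves `∂ₜ c(t) = -∇·(c(t) C(c(t)) ∇f)`.  The equation is
understood weakly, tested against the smooth functions that are bounded with bounded gradient. -/
def IsDualGeodesic {n : ℕ} (C : Mobility n) (f : Euc n → ℝ) (c : ℝ → Measure (Euc n)) : Prop :=
  ∀ φ : Euc n → ℝ, ContDiff ℝ (⊤ : ℕ∞) φ → (∃ K : ℝ, ∀ x, |φ x| ≤ K ∧ ‖gradient φ x‖ ≤ K) →
    ∀ t ∈ Set.Icc (0 : ℝ) 1,
      HasDerivWithinAt (fun s => ∫ x, φ x ∂(c s))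
        (∫ x, inner ℝ (gradient φ x) (velocity C f (c t) x) ∂(c t)) (Set.Icc 0 1) t

/-- The time-weighted kinetic energy `∫₀¹ t ⟨⟨[f], [f]⟩⟩_{c(t)} dt` of a dual geodesic. -/
def weightedEnergy {n : ℕ} (C : Mobility n) (f : Euc n → ℝ) (c : ℝ → Measure (Euc n)) : ℝ≥0∞ :=
  ∫⁻ t in Set.Icc (0 : ℝ) 1,
    ENNReal.ofReal (t * ∫ x, inner ℝ (gradient f x) (velocity C f (c t) x) ∂(c t))

/-- The quadratic potential `x ↦ ½ xᵀ S x + bᵀ x`. -/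
def quadPotential {n : ℕ} (S : Matrix (Fin n) (Fin n) ℝ) (b : Euc n) (x : Euc n) : ℝ :=
  1 / 2 * inner ℝ x (act S x) + inner ℝ b x

/-- `c` is a curve of nondegenerate Gaussian measures on `[0, 1]`. -/
def IsGaussianCurve {n : ℕ} (c : ℝ → Measure (Euc n)) : Prop :=
  ∀ t ∈ Set.Icc (0 : ℝ) 1, ∃ (a : Euc n) (S : Matrix (Fin n) (Fin n) ℝ),
    S.PosDef ∧ c t = multivariateGaussian a S

/-- The divergence `D(μ | ν)` of a transport geometry on Gaussian measures: the infimum of the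
time-weighted kinetic energy over the dual geodesics from `μ` to `ν`.  As usual on `ℝⁿ`, the
geodesics are those of the Gaussian family: Gaussian at all times, with quadratic potential. -/
def gaussianDivergence {n : ℕ} (C : Mobility n) (μ ν : Measure (Euc n)) : ℝ≥0∞ :=
  ⨅ (c : ℝ → Measure (Euc n)) (S : Matrix (Fin n) (Fin n) ℝ) (b : Euc n)
    (_ : S.IsSymm ∧ IsGaussianCurve c ∧ IsDualGeodesic C (quadPotential S b) c ∧
      c 0 = μ ∧ c 1 = ν),
    weightedEnergy C (quadPotential S b) c

/-- The three regularizers: Kullback-Leibler, Wasserstein-KL and Kalman-Wasserstein. -/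
inductive Regularizer
  | KL
  | WKL
  | KW

/-- The divergence belonging to a regularizer; `lam` is only used by `KW`. -/
def Regularizer.divergence {n : ℕ} (lam : ℝ) (r : Regularizer) (μ ν : Measure (Euc n)) : ℝ≥0∞ :=
  match r with
  | .KL => klDiv μ ν
  | .WKL => gaussianDivergence (ottoMobility n) μ ν
  | .KW => gaussianDivergence (kalmanMobility n lam) μ ν

/-! ### The regularized control problem -/

/-- The trajectory of `x_{t+1} = A x_t + B u_t + w_t` under the feedback `u_t = F x_t`. -/
def trajectory {n m : ℕ} (A : Matrix (Fin n) (Fin n) ℝ) (B : Matrix (Fin n) (Fin m) ℝ)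
    (F : Matrix (Fin m) (Fin n) ℝ) (x₀ : Euc n) (w : ℕ → Euc n) : ℕ → Euc n
  | 0 => x₀
  | t + 1 =>
    act A (trajectory A B F x₀ w t) + act B (act F (trajectory A B F x₀ w t)) + w t

/-- `x₀ ∼ N(0, S₀)`, the `w t` are i.i.d. with law `N(0, Sw)`, and `x₀` is independent of the
noise sequence. -/
structure IsGaussianModel {n : ℕ} {Ω : Type*} [MeasurableSpace Ω] (Pr : Measure Ω)
    (S₀ Sw : Matrix (Fin n) (Fin n) ℝ) (x₀ : Ω → Euc n) (w : ℕ → Ω → Euc n) : Prop where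
  measurable_init : Measurable x₀
  measurable_noise : ∀ t, Measurable (w t)
  law_init : Pr.map x₀ = multivariateGaussian 0 S₀
  law_noise : ∀ t, Pr.map (w t) = multivariateGaussian 0 Sw
  indep_noise : iIndepFun w Pr
  indep_init : IndepFun x₀ (fun o t => w t o) Pr

/-- The stage cost `½ xᵀ Q x + D(N(A x + B u, Sw) | N(A x, Sw))`. -/
def stageCost {n m : ℕ} (r : Regularizer) (lam : ℝ) (A : Matrix (Fin n) (Fin n) ℝ)
    (B : Matrix (Fin n) (Fin m) ℝ) (Q Sw : Matrix (Fin n) (Fin n) ℝ)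
    (x : Euc n) (u : Euc m) : ℝ≥0∞ :=
  ENNReal.ofReal (1 / 2 * inner ℝ x (act Q x)) +
    r.divergence lam (multivariateGaussian (act A x + act B u) Sw)
      (multivariateGaussian (act A x) Sw)

/-- The regularized discounted cost `𝔼[∑ₜ γᵗ (½ xₜᵀ Q xₜ + D(pₜ | p₀))]`, in `[0, ∞]`, of the
linear feedback policy `u_t = F x_t`. -/
def regularizedCost {n m : ℕ} {Ω : Type*} [MeasurableSpace Ω] (Pr : Measure Ω)
    (x₀ : Ω → Euc n) (w : ℕ → Ω → Euc n)
    (r : Regularizer) (lam γ : ℝ) (A : Matrix (Fin n) (Fin n) ℝ)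
    (B : Matrix (Fin n) (Fin m) ℝ) (Q Sw : Matrix (Fin n) (Fin n) ℝ)
    (F : Matrix (Fin m) (Fin n) ℝ) : ℝ≥0∞ :=
  ∫⁻ o, ∑' t : ℕ, ENNReal.ofReal (γ ^ t) *
    stageCost r lam A B Q Sw (trajectory A B F (x₀ o) (fun s => w s o) t)
      (act F (trajectory A B F (x₀ o) (fun s => w s o) t)) ∂Pr

/-! ### Stabilizability, detectability, the Riccati equation and the gains -/

/-- The spectral radius of a real square matrix (over its complex eigenvalues). -/
def specRadius {n : ℕ} (M : Matrix (Fin n) (Fin n) ℝ) : ℝ≥0∞ :=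
  spectralRadius ℂ (M.map (algebraMap ℝ ℂ))

/-- `(A, B)` is stabilizable: `A + B K` is Schur stable for some `K`. -/
def IsStabilizable {n m : ℕ} (A : Matrix (Fin n) (Fin n) ℝ) (B : Matrix (Fin n) (Fin m) ℝ) :
    Prop :=
  ∃ K : Matrix (Fin m) (Fin n) ℝ, specRadius (A + B * K) < 1

/-- `(A, C)` is detectable: `A + L C` is Schur stable for some `L`. -/
def IsDetectable {n p : ℕ} (A : Matrix (Fin n) (Fin n) ℝ) (C : Matrix (Fin p) (Fin n) ℝ) :
    Prop :=
  ∃ L : Matrix (Fin n) (Fin p) ℝ, specRadius (A + L * C) < 1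

/-- The effective control penalty of a regularizer. -/
def Regularizer.penalty {n m : ℕ} (lam : ℝ) (B : Matrix (Fin n) (Fin m) ℝ)
    (Sw : Matrix (Fin n) (Fin n) ℝ) : Regularizer → Matrix (Fin m) (Fin m) ℝ
  | .KL => Bᵀ * Sw⁻¹ * B
  | .WKL => Bᵀ * B
  | .KW => Bᵀ * (Sw + lam • 1)⁻¹ * B

/-- The discounted discrete algebraic Riccati equation
`A_γᵀ P A_γ - P + Q - A_γᵀ P B (Bᵀ P B + R_γ)⁻¹ Bᵀ P A_γ = 0`
with `A_γ = √γ A` and `R_γ = γ⁻¹ R`. -/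
def SolvesDARE {n m : ℕ} (γ : ℝ) (A : Matrix (Fin n) (Fin n) ℝ) (B : Matrix (Fin n) (Fin m) ℝ)
    (Q : Matrix (Fin n) (Fin n) ℝ) (R : Matrix (Fin m) (Fin m) ℝ)
    (P : Matrix (Fin n) (Fin n) ℝ) : Prop :=
  (√γ • A)ᵀ * P * (√γ • A) - P + Q
    - (√γ • A)ᵀ * P * B * (Bᵀ * P * B + γ⁻¹ • R)⁻¹ * Bᵀ * P * (√γ • A) = 0

/-- The positive semidefinite solution of the Riccati equation (arbitrary if there is none). -/
def dareSolution {n m : ℕ} (γ : ℝ) (A : Matrix (Fin n) (Fin n) ℝ) (B : Matrix (Fin n) (Fin m) ℝ)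
    (Q : Matrix (Fin n) (Fin n) ℝ) (R : Matrix (Fin m) (Fin m) ℝ) : Matrix (Fin n) (Fin n) ℝ :=
  Classical.epsilon fun P : Matrix (Fin n) (Fin n) ℝ => P.PosSemidef ∧ SolvesDARE γ A B Q R P

/-- The gain `-γ (R + γ Bᵀ P B)⁻¹ Bᵀ P A`. -/
def riccatiGain {n m : ℕ} (γ : ℝ) (A : Matrix (Fin n) (Fin n) ℝ) (B : Matrix (Fin n) (Fin m) ℝ)
    (R : Matrix (Fin m) (Fin m) ℝ) (P : Matrix (Fin n) (Fin n) ℝ) : Matrix (Fin m) (Fin n) ℝ :=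
  -(γ • ((R + γ • (Bᵀ * P * B))⁻¹ * Bᵀ * P * A))

/-- The gain `F` of a regularizer, built from its penalty and its Riccati solution. -/
def Regularizer.gain {n m : ℕ} (r : Regularizer) (lam γ : ℝ) (A : Matrix (Fin n) (Fin n) ℝ)
    (B : Matrix (Fin n) (Fin m) ℝ) (Q Sw : Matrix (Fin n) (Fin n) ℝ) :
    Matrix (Fin m) (Fin n) ℝ :=
  riccatiGain γ A B (r.penalty lam B Sw) (dareSolution γ A B Q (r.penalty lam B Sw))

end RegularizedLQR

end

open RegularizedLQR

/-! Each of the three divergences between translates of one Gaussian is a quadratic form in the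
shift, so the regularized problem is a discounted linear-quadratic problem with control weight
`r.penalty` (`divergence_eq`). For KL this is the Cameron-Martin density. For the transport
divergences, let `K(σ)` be the mobility at covariance `σ` and `S` the Hessian of the potential.
Testing the continuity equation with `cos ⟨ξ, x⟩` and `sin ⟨ξ, x⟩` gives `σ' = K S σ + σ S K`, so
`tr (S σ)` has derivative `2 tr (S K S σ)`, which is positive unless `S = 0`. Since the two
endpoints have the same covariance, `S = 0`: the potential is affine, the curve is a translation
with constant velocity, and its energy is forced (`gaussianDivergence_eq`).

The control part rests on completing the square (`bellman_eq`): the Riccati operator is the minimum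
over gains of the one-step cost. Value iteration from zero increases and is bounded thanks to
stabilizability, so it converges to a solution (`exists_riccatiOp_eq`). Detectability makes the gain
of any positive semidefinite solution stable for the discounted dynamics; hence every subsolution
lies below every solution (`qf_le_of_le_bellman`), and solutions are unique. Along the closed loop
the same square telescopes. If a gain `F` has finite cost, the discounted terminal term vanishes,
and the excess over the optimum contains the time-one moment of a nonzero semidefinite form, which
is positive because the noise is nondegenerate (`regularizedCost_riccatiGain_lt`).

For `Σ_w = ρ I` and `λ = 1` the penalties are `s BᵀB` with `s = 1/ρ` (KL), `1/(ρ+1)` (KW) and `1`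
(WKL). The comparison principle shows that the value `xᵀ P(s) x` is increasing and concave in `s`,
and completing the square bounds the distance between gains by differences of values
(`mul_qf_gain_sub_le`). Concavity gives continuity at `s = 1`, hence the low-noise limit of KW; it
also controls the difference quotient near `s = 0`, hence the merging of KW and KL. If `√γ A` is
stable, `P(s)` is bounded uniformly in `s`, so a penalty tending to infinity forces the gain to
zero. -/

namespace RegularizedLQR

/-! ### Quadratic forms of matrices -/

/-- The quadratic form `x ↦ xᵀ M x`. -/
noncomputable def qf {n : ℕ} (M : Matrix (Fin n) (Fin n) ℝ) (x : Fin n → ℝ) : ℝ := x ⬝ᵥ M *ᵥ x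

section QuadraticForms

variable {n m : ℕ}

lemma qf_add (M N : Matrix (Fin n) (Fin n) ℝ) (x : Fin n → ℝ) :
    qf (M + N) x = qf M x + qf N x := by
  simp [qf, Matrix.add_mulVec, dotProduct_add]

lemma qf_sub (M N : Matrix (Fin n) (Fin n) ℝ) (x : Fin n → ℝ) :
    qf (M - N) x = qf M x - qf N x := by
  simp [qf, Matrix.sub_mulVec, dotProduct_sub]

lemma qf_smul (c : ℝ) (M : Matrix (Fin n) (Fin n) ℝ) (x : Fin n → ℝ) :
    qf (c • M) x = c * qf M x := by
  simp [qf, Matrix.smul_mulVec, dotProduct_smul]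

lemma qf_conj (M : Matrix (Fin n) (Fin n) ℝ) (C : Matrix (Fin n) (Fin m) ℝ) (x : Fin m → ℝ) :
    qf (Cᵀ * M * C) x = qf M (C *ᵥ x) := by
  simp only [qf, Matrix.mul_assoc, ← Matrix.mulVec_mulVec]
  rw [Matrix.mulVec_transpose, dotProduct_comm, ← Matrix.dotProduct_mulVec, dotProduct_comm]

lemma qf_transpose_mul_self (C : Matrix (Fin m) (Fin n) ℝ) (x : Fin n → ℝ) :
    qf (Cᵀ * C) x = qf 1 (C *ᵥ x) := by
  rw [← qf_conj, Matrix.mul_one]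

lemma qf_nonneg {M : Matrix (Fin n) (Fin n) ℝ} (hM : M.PosSemidef) (x : Fin n → ℝ) :
    0 ≤ qf M x := by
  simpa [qf] using hM.dotProduct_mulVec_nonneg x

lemma qf_pos {M : Matrix (Fin n) (Fin n) ℝ} (hM : M.PosDef) {x : Fin n → ℝ} (hx : x ≠ 0) :
    0 < qf M x := by
  simpa [qf] using hM.dotProduct_mulVec_pos hx

lemma posSemidef_of_qf_nonneg {M : Matrix (Fin n) (Fin n) ℝ} (hM : M.IsSymm)
    (h : ∀ x, 0 ≤ qf M x) : M.PosSemidef :=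
  .of_dotProduct_mulVec_nonneg (by simpa [Matrix.IsHermitian, Matrix.IsSymm] using hM) (by simpa [qf] using h)

lemma posDef_of_qf_pos {M : Matrix (Fin n) (Fin n) ℝ} (hM : M.IsSymm)
    (h : ∀ x, x ≠ 0 → 0 < qf M x) : M.PosDef :=
  .of_dotProduct_mulVec_pos (by simpa [Matrix.IsHermitian, Matrix.IsSymm] using hM)
    (fun x hx => by simpa [qf] using h x hx)

lemma isSymm_of_posSemidef {M : Matrix (Fin n) (Fin n) ℝ} (hM : M.PosSemidef) : M.IsSymm := by
  simpa [Matrix.IsHermitian, Matrix.IsSymm] using hM.1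

lemma qf_zero_right (M : Matrix (Fin n) (Fin n) ℝ) : qf M 0 = 0 := by simp [qf]

lemma qf_add_right {M : Matrix (Fin n) (Fin n) ℝ} (hM : M.IsSymm) (x y : Fin n → ℝ) :
    qf M (x + y) = qf M x + 2 * (x ⬝ᵥ M *ᵥ y) + qf M y := by
  have : y ⬝ᵥ M *ᵥ x = x ⬝ᵥ M *ᵥ y := by
    rw [Matrix.dotProduct_mulVec, ← Matrix.mulVec_transpose, hM, dotProduct_comm]
  simp only [qf, Matrix.mulVec_add, dotProduct_add, add_dotProduct, this]
  ring

lemma qf_smul_right (M : Matrix (Fin n) (Fin n) ℝ) (c : ℝ) (x : Fin n → ℝ) :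
    qf M (c • x) = c ^ 2 * qf M x := by
  simp [qf, Matrix.mulVec_smul, dotProduct_smul, smul_dotProduct]; ring

/-- Polarization. Through it, equality, limits and derivatives of matrices are all read off from
quadratic forms. -/
lemma apply_eq_qf {M : Matrix (Fin n) (Fin n) ℝ} (hM : M.IsSymm) (i j : Fin n) :
    M i j = (qf M (Pi.single i 1 + Pi.single j 1) - qf M (Pi.single i 1)
      - qf M (Pi.single j 1)) / 2 := by
  rw [qf_add_right hM]; simp; ring

lemma eq_of_qf_eq {M N : Matrix (Fin n) (Fin n) ℝ} (hM : M.IsSymm) (hN : N.IsSymm)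
    (h : ∀ x, qf M x = qf N x) : M = N := by
  ext i j
  rw [apply_eq_qf hM, apply_eq_qf hN, h, h, h]

lemma qf_one (x : Fin n → ℝ) : qf 1 x = ∑ i, x i ^ 2 := by
  simp [qf, dotProduct, sq]

/-- The explicit constant matters: it tends to zero with `M`, which `lyapunovStable_of_tendsto_pow`
uses. -/
lemma qf_le_mul_qf_one (M : Matrix (Fin n) (Fin n) ℝ) :
    ∀ x, qf M x ≤ (∑ i, ∑ j, |M i j|) * qf 1 x := by
  intro x
  rw [qf_one, Finset.sum_mul]
  simp only [qf, dotProduct, Matrix.mulVec, Finset.mul_sum, Finset.sum_mul (s := Finset.univ)]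
  refine Finset.sum_le_sum fun i _ => Finset.sum_le_sum fun j _ => ?_
  rw [← Finset.mul_sum]
  have hi : x i ^ 2 ≤ ∑ k, x k ^ 2 :=
    Finset.single_le_sum (f := fun k => x k ^ 2) (fun _ _ => sq_nonneg _) (Finset.mem_univ i)
  have hj : x j ^ 2 ≤ ∑ k, x k ^ 2 :=
    Finset.single_le_sum (f := fun k => x k ^ 2) (fun _ _ => sq_nonneg _) (Finset.mem_univ j)
  have h1 : |x i * x j| ≤ ∑ k, x k ^ 2 := by
    rw [abs_le]
    constructor <;> nlinarith [sq_nonneg (x i + x j), sq_nonneg (x i - x j)]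
  calc x i * (M i j * x j) = M i j * (x i * x j) := by ring
    _ ≤ |M i j * (x i * x j)| := le_abs_self _
    _ = |M i j| * |x i * x j| := abs_mul _ _
    _ ≤ _ := by gcongr

/-- With `D = √X`, write `x = D⁻¹ (D x)` and use `|D x|² = xᵀ X x`. -/
lemma qf_one_le_mul_qf {X : Matrix (Fin n) (Fin n) ℝ} (hX : X.PosDef) :
    ∃ c, 0 ≤ c ∧ ∀ x, qf 1 x ≤ c * qf X x := by
  set D := CFC.sqrt X with hD
  have hDs : D.IsSymm := isSymm_of_posSemidef (Matrix.nonneg_iff_posSemidef.1 (CFC.sqrt_nonneg X))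
  have hDD : Dᵀ * D = X := by
    rw [hDs]; exact CFC.sqrt_mul_sqrt_self _ hX.posSemidef.nonneg
  have hu : IsUnit D := by
    rw [Matrix.isUnit_iff_isUnit_det]
    have := (Matrix.isUnit_iff_isUnit_det _).1 hX.isUnit
    rw [← hDD, Matrix.det_mul] at this
    exact isUnit_of_mul_isUnit_right this
  refine ⟨∑ i, ∑ j, |((D⁻¹)ᵀ * D⁻¹) i j|, by positivity, fun x => ?_⟩
  · have := qf_le_mul_qf_one ((D⁻¹)ᵀ * D⁻¹) (D *ᵥ x)
    rwa [qf_transpose_mul_self, Matrix.mulVec_mulVec,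
      Matrix.nonsing_inv_mul _ ((Matrix.isUnit_iff_isUnit_det _).1 hu), Matrix.one_mulVec,
      ← qf_transpose_mul_self, hDD] at this

lemma qf_le_mul_qf (M : Matrix (Fin n) (Fin n) ℝ) {X : Matrix (Fin n) (Fin n) ℝ} (hX : X.PosDef) :
    ∃ c, 0 ≤ c ∧ ∀ x, qf M x ≤ c * qf X x := by
  obtain ⟨c, hc, h⟩ := qf_one_le_mul_qf hX
  refine ⟨(∑ i, ∑ j, |M i j|) * c, by positivity, fun x => (qf_le_mul_qf_one M x).trans ?_⟩
  rw [mul_assoc]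
  gcongr
  exact h x

/-- Young's inequality: expand the nonnegative form at `ε x - y` and divide by `ε`. -/
lemma qf_add_le {X : Matrix (Fin n) (Fin n) ℝ} (hX : X.PosSemidef) {ε : ℝ} (hε : 0 < ε)
    (x y : Fin n → ℝ) : qf X (x + y) ≤ (1 + ε) * qf X x + (1 + 1 / ε) * qf X y := by
  have h := qf_nonneg hX (ε • x + (-1 : ℝ) • y)
  rw [qf_add_right (isSymm_of_posSemidef hX), qf_smul_right, qf_smul_right] at h
  rw [qf_add_right (isSymm_of_posSemidef hX)]
  simp only [Matrix.mulVec_smul, dotProduct_smul, smul_dotProduct, smul_eq_mul] at h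
  have h2 : 0 ≤ ε * qf X x - 2 * (x ⬝ᵥ X *ᵥ y) + 1 / ε * qf X y := by
    have := mul_nonneg (one_div_pos.2 hε).le h
    field_simp at this ⊢
    linarith
  have h' := qf_nonneg hX (ε • x + y)
  have hs := qf_nonneg hX x
  linarith

/-- Each real sequence `qf (P k) x` converges by monotonicity, and polarization transfers this to
the entries. -/
lemma exists_tendsto_of_monotone_qf {P : ℕ → Matrix (Fin n) (Fin n) ℝ}
    (hs : ∀ k, (P k).IsSymm) (hm : ∀ x, Monotone fun k => qf (P k) x)
    {b : (Fin n → ℝ) → ℝ} (hb : ∀ k x, qf (P k) x ≤ b x) :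
    ∃ Q, Tendsto P atTop (𝓝 Q) := by
  have h : ∀ x, ∃ l, Tendsto (fun k => qf (P k) x) atTop (𝓝 l) := fun x =>
    ⟨_, tendsto_atTop_ciSup (hm x) ⟨b x, by rintro _ ⟨k, rfl⟩; exact hb k x⟩⟩
  choose l hl using h
  refine ⟨Matrix.of fun i j => (l (Pi.single i 1 + Pi.single j 1) - l (Pi.single i 1)
      - l (Pi.single j 1)) / 2, ?_⟩
  refine tendsto_pi_nhds.2 fun i => tendsto_pi_nhds.2 fun j => ?_
  simp only [Matrix.of_apply]
  refine ((((hl _).sub (hl _)).sub (hl _)).div_const 2).congr fun k => ?_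
  rw [apply_eq_qf (hs k)]

lemma continuous_qf (x : Fin n → ℝ) : Continuous fun M : Matrix (Fin n) (Fin n) ℝ => qf M x := by
  unfold qf; fun_prop

lemma mulVec_injective_of_rank {B : Matrix (Fin n) (Fin m) ℝ} (hB : B.rank = m) :
    Function.Injective B.mulVec := by
  have := LinearMap.finrank_range_add_finrank_ker B.mulVecLin
  rw [Matrix.rank] at hB
  rw [hB] at this
  simp only [Module.finrank_fintype_fun_eq_card, Fintype.card_fin, Nat.add_eq_left] at this
  exact LinearMap.ker_eq_bot.1 (Submodule.finrank_eq_zero.1 this)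

lemma posDef_conj_of_rank {B : Matrix (Fin n) (Fin m) ℝ} (hB : B.rank = m)
    {M : Matrix (Fin n) (Fin n) ℝ} (hM : M.PosDef) : (Bᵀ * M * B).PosDef := by
  refine posDef_of_qf_pos ?_ fun x hx => ?_
  · have := isSymm_of_posSemidef hM.posSemidef
    simp [Matrix.IsSymm, Matrix.mul_assoc, this.eq]
  · rw [qf_conj]
    exact qf_pos hM fun h => hx (mulVec_injective_of_rank hB (by simpa using h))

end QuadraticForms

/-! ### Lyapunov functions -/

section Lyapunov

variable {n m p : ℕ}

/-- `√γ M` contracts the norm of some positive definite quadratic form. -/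
def LyapunovStable (γ : ℝ) (M : Matrix (Fin n) (Fin n) ℝ) : Prop :=
  ∃ X : Matrix (Fin n) (Fin n) ℝ, X.PosDef ∧ ∃ θ : ℝ, 0 ≤ θ ∧ θ < 1 ∧
    ∀ x, γ * qf X (M *ᵥ x) ≤ θ * qf X x

/-- Once `|M^k x|² ≤ |x|² / 2`, the form `X = ∑_{j<k} (M^j)ᵀ M^j` is a Lyapunov function: the sum
telescopes to `X(M x) = X(x) - |x|² + |M^k x|²`, a decrease of at least `|x|² / 2`. -/
lemma lyapunovStable_of_tendsto_pow {M : Matrix (Fin n) (Fin n) ℝ}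
    (h : Tendsto (fun k => M ^ k) atTop (𝓝 0)) : LyapunovStable 1 M := by
  have h0 : Tendsto (fun k : ℕ => ∑ i : Fin n, ∑ j : Fin n, |((M ^ k)ᵀ * M ^ k) i j|) atTop (𝓝 0) := by
    have hc : Continuous fun N : Matrix (Fin n) (Fin n) ℝ => ∑ i, ∑ j, |(Nᵀ * N) i j| := by
      refine continuous_finsetSum _ fun i _ => continuous_finsetSum _ fun j _ => ?_
      exact ((Continuous.matrix_elem (by fun_prop) i j)).abs
    exact (hc.tendsto' 0 0 (by simp)).comp h
  obtain ⟨k, hk, hk1⟩ := ((h0.eventually (gt_mem_nhds (show (0 : ℝ) < 1 / 2 by norm_num))).and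
    (eventually_ge_atTop 1)).exists
  have hM : ∀ x, qf 1 (M ^ k *ᵥ x) ≤ 1 / 2 * qf 1 x := fun x => by
    rw [← qf_transpose_mul_self]
    refine (qf_le_mul_qf_one _ x).trans ?_
    have := qf_nonneg Matrix.PosSemidef.one x
    gcongr
  set X : Matrix (Fin n) (Fin n) ℝ := ∑ j ∈ Finset.range k, (M ^ j)ᵀ * M ^ j with hX
  have hqX : ∀ x, qf X x = ∑ j ∈ Finset.range k, qf 1 (M ^ j *ᵥ x) := fun x => by
    simp_rw [← qf_transpose_mul_self]
    simp only [hX, qf, Matrix.sum_mulVec, dotProduct_sum]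
  have hle : ∀ x, qf 1 x ≤ qf X x := fun x => by
    rw [hqX]
    refine le_trans (by simp) (Finset.single_le_sum (f := fun j => qf 1 (M ^ j *ᵥ x))
      (fun j _ => qf_nonneg .one _) (Finset.mem_range.2 (show 0 < k by omega)))
  have hpd : X.PosDef := by
    refine posDef_of_qf_pos ?_ fun x hx => (qf_pos .one hx).trans_le (hle x)
    simp [hX, Matrix.IsSymm, Matrix.transpose_sum]
  obtain ⟨c, hc, hcX⟩ := qf_le_mul_qf X (Matrix.PosDef.one (n := Fin n) (R := ℝ))
  -- From `X ≤ c |x|²` the decrease is at least the fraction `1 / (2 (c + 1))` of `X`; the `+ 1`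
  -- avoids dividing by zero.
  refine ⟨X, hpd, 1 - 1 / (2 * (c + 1)), ?_, ?_, fun x => ?_⟩
  · rw [sub_nonneg, div_le_one (by positivity)]; linarith
  · have : 0 < 1 / (2 * (c + 1)) := by positivity
    linarith
  · have e : qf X (M *ᵥ x) = qf X x - qf 1 x + qf 1 (M ^ k *ᵥ x) := by
      have h1 := Finset.sum_range_succ (fun j => qf 1 (M ^ j *ᵥ x)) k
      rw [Finset.sum_range_succ'] at h1
      rw [hqX, hqX]
      simp only [Matrix.mulVec_mulVec, ← pow_succ]
      simp only [pow_zero, Matrix.one_mulVec] at h1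
      linarith
    have h1 : 1 / (2 * (c + 1)) * qf X x ≤ 1 / 2 * qf 1 x := by
      have := hcX x
      have := qf_nonneg .one x
      rw [div_mul_eq_mul_div, div_le_iff₀ (by positivity)]
      nlinarith
    have := hM x
    rw [e]; linarith

lemma LyapunovStable.mono {γ : ℝ} {M : Matrix (Fin n) (Fin n) ℝ} (hγ : γ ≤ 1)
    (h : LyapunovStable 1 M) : LyapunovStable γ M := by
  obtain ⟨X, hX, θ, h0, h1, hx⟩ := h
  refine ⟨X, hX, θ, h0, h1, fun x => le_trans ?_ (hx x)⟩
  have := qf_nonneg hX.posSemidef (M *ᵥ x)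
  gcongr

lemma lyapunovStable_of_sqrt_smul {γ : ℝ} {M : Matrix (Fin n) (Fin n) ℝ} (hγ : 0 ≤ γ)
    (h : LyapunovStable 1 (√γ • M)) : LyapunovStable γ M := by
  obtain ⟨X, hX, θ, h0, h1, hx⟩ := h
  refine ⟨X, hX, θ, h0, h1, fun x => ?_⟩
  simpa [Matrix.smul_mulVec, qf_smul_right, Real.sq_sqrt hγ] using hx x

end Lyapunov

/-- Gelfand's formula for the complexified matrix makes the norms of the powers decay geometrically;
taking real parts returns to the real matrix. -/
lemma tendsto_pow_of_specRadius_lt {n : ℕ} {M : Matrix (Fin n) (Fin n) ℝ} {c : ℝ} (hc : 0 < c)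
    (h : specRadius M < ENNReal.ofReal (1 / c)) :
    Tendsto (fun k => (c • M) ^ k) atTop (𝓝 0) := by
  let _ : NormedRing (Matrix (Fin n) (Fin n) ℂ) := Matrix.linftyOpNormedRing
  let _ : NormedAlgebra ℂ (Matrix (Fin n) (Fin n) ℂ) := Matrix.linftyOpNormedAlgebra
  have _ : CompleteSpace (Matrix (Fin n) (Fin n) ℂ) := FiniteDimensional.complete ℂ _
  set N := M.map (algebraMap ℝ ℂ) with hN
  have hg := spectrum.pow_nnnorm_pow_one_div_tendsto_nhds_spectralRadius N
  obtain ⟨r, hr1, hr2⟩ := exists_between h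
  have hev := hg.eventually (gt_mem_nhds hr1)
  have hrt : r ≠ ⊤ := (hr2.trans ENNReal.ofReal_lt_top).ne
  have hrc : c * r.toReal < 1 := by
    have := (ENNReal.lt_ofReal_iff_toReal_lt hrt).1 hr2
    rwa [lt_div_iff₀ hc, mul_comm] at this
  have hb : ∀ᶠ k : ℕ in atTop, ‖(c • N) ^ k‖ ≤ (c * r.toReal) ^ k := by
    filter_upwards [hev, eventually_ge_atTop 1] with k hk hk1
    have hk' : (‖N ^ k‖₊ : ℝ≥0∞) ≤ r ^ k := by
      have h1 := ENNReal.rpow_le_rpow hk.le (show (0 : ℝ) ≤ k by positivity)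
      rwa [← ENNReal.rpow_mul, one_div_mul_cancel (by positivity), ENNReal.rpow_one,
        ENNReal.rpow_natCast] at h1
    have hk2 : ‖N ^ k‖ ≤ r.toReal ^ k := by
      have := ENNReal.toReal_mono (ENNReal.pow_ne_top hrt) hk'
      simpa using this
    rw [smul_pow, mul_pow]
    refine (norm_smul_le _ _).trans ?_
    rw [norm_pow, Real.norm_of_nonneg hc.le]
    gcongr
  have h0 : Tendsto (fun k => (c • N) ^ k) atTop (𝓝 0) :=
    squeeze_zero_norm' hb (tendsto_pow_atTop_nhds_zero_of_lt_one (by positivity) hrc)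
  have hre : Continuous fun X : Matrix (Fin n) (Fin n) ℂ => X.map Complex.re :=
    Continuous.matrix_map continuous_id Complex.continuous_re
  have h1 := (hre.tendsto 0).comp h0
  have : (0 : Matrix (Fin n) (Fin n) ℂ).map Complex.re = 0 := by ext; simp
  rw [this] at h1
  refine h1.congr fun k => ?_
  have hk : (c • N) ^ k = ((c • M) ^ k).map (algebraMap ℝ ℂ) := by
    have e : c • N = (algebraMap ℝ ℂ).mapMatrix (c • M) := by
      ext i j; simp [hN]
    rw [e, ← map_pow]; rfl
  rw [Function.comp_apply, hk]
  ext i j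
  simp

lemma lyapunovStable_of_specRadius_lt_one {n : ℕ} {M : Matrix (Fin n) (Fin n) ℝ}
    (h : specRadius M < 1) : LyapunovStable 1 M := by
  refine lyapunovStable_of_tendsto_pow ?_
  simpa using tendsto_pow_of_specRadius_lt (c := 1) one_pos (by simpa using h)

/-! ### The Riccati equation -/

section Riccati

variable {n m p : ℕ} {γ : ℝ} {A : Matrix (Fin n) (Fin n) ℝ} {B : Matrix (Fin n) (Fin m) ℝ}
  {Q : Matrix (Fin n) (Fin n) ℝ} {R : Matrix (Fin m) (Fin m) ℝ}

/-- The discounted Riccati operator. -/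
noncomputable def riccatiOp (γ : ℝ) (A : Matrix (Fin n) (Fin n) ℝ) (B : Matrix (Fin n) (Fin m) ℝ)
    (Q : Matrix (Fin n) (Fin n) ℝ) (R : Matrix (Fin m) (Fin m) ℝ) (P : Matrix (Fin n) (Fin n) ℝ) :
    Matrix (Fin n) (Fin n) ℝ :=
  Q + γ • (Aᵀ * P * A) - γ ^ 2 • (Aᵀ * P * B * (R + γ • (Bᵀ * P * B))⁻¹ * (Bᵀ * P * A))

/-- The one-step cost of the gain `F`, with terminal cost `P`. -/
noncomputable def bellman (γ : ℝ) (A : Matrix (Fin n) (Fin n) ℝ) (B : Matrix (Fin n) (Fin m) ℝ)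
    (Q : Matrix (Fin n) (Fin n) ℝ) (R : Matrix (Fin m) (Fin m) ℝ) (F : Matrix (Fin m) (Fin n) ℝ)
    (P : Matrix (Fin n) (Fin n) ℝ) (x : Fin n → ℝ) : ℝ :=
  qf Q x + qf R (F *ᵥ x) + γ * qf P ((A + B * F) *ᵥ x)

lemma posDef_penalty (hγ : 0 ≤ γ) (hR : R.PosDef) {P : Matrix (Fin n) (Fin n) ℝ}
    (hP : P.PosSemidef) (B : Matrix (Fin n) (Fin m) ℝ) : (R + γ • (Bᵀ * P * B)).PosDef := by
  have := hP.conjTranspose_mul_mul_same B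
  rw [Matrix.conjTranspose_eq_transpose_of_trivial] at this
  exact hR.add_posSemidef (this.smul hγ)

/-- Only the placement of `γ` differs: `(BᵀPB + γ⁻¹R)⁻¹ = γ (R + γ BᵀPB)⁻¹`, and the two factors
`√γ` multiply to `γ`. -/
lemma solvesDARE_iff (hγ : 0 < γ) (hR : R.PosDef) {P : Matrix (Fin n) (Fin n) ℝ}
    (hP : P.PosSemidef) : SolvesDARE γ A B Q R P ↔ riccatiOp γ A B Q R P = P := by
  have hH := posDef_penalty hγ.le hR hP B
  have hdet := (Matrix.isUnit_iff_isUnit_det _).1 hH.isUnit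
  have hinv : (Bᵀ * P * B + γ⁻¹ • R)⁻¹ = γ • (R + γ • (Bᵀ * P * B))⁻¹ := by
    have e : Bᵀ * P * B + γ⁻¹ • R = γ⁻¹ • (R + γ • (Bᵀ * P * B)) := by
      rw [smul_add, smul_smul, inv_mul_cancel₀ hγ.ne', one_smul, add_comm]
    rw [e]
    refine Matrix.inv_eq_right_inv ?_
    rw [Matrix.smul_mul, Matrix.mul_smul, smul_smul, inv_mul_cancel₀ hγ.ne', one_smul,
      Matrix.mul_nonsing_inv _ hdet]
  have hs : √γ * √γ = γ := Real.mul_self_sqrt hγ.le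
  rw [SolvesDARE, hinv, riccatiOp, ← sub_eq_zero (b := P)]
  simp only [Matrix.transpose_smul, Matrix.smul_mul, Matrix.mul_smul, smul_smul, hs,
    Matrix.mul_assoc]
  rw [show √γ * (γ * √γ) = γ ^ 2 by rw [mul_left_comm, hs, sq]]
  constructor <;> intro h <;> rw [← h] <;> abel

/-- Completion of the square in the control `u = F x` around its minimizer, the Riccati feedback
`v`, which solves `H v = -γ BᵀPA x`. Optimality, uniqueness and the comparison of gains all come
from this identity. -/
lemma bellman_eq (hγ : 0 ≤ γ) (hR : R.PosDef) {P : Matrix (Fin n) (Fin n) ℝ}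
    (hP : P.PosSemidef) (F : Matrix (Fin m) (Fin n) ℝ) (x : Fin n → ℝ) :
    bellman γ A B Q R F P x = qf (riccatiOp γ A B Q R P) x +
      qf (R + γ • (Bᵀ * P * B)) ((F - riccatiGain γ A B R P) *ᵥ x) := by
  have hPs := isSymm_of_posSemidef hP
  have hH := posDef_penalty hγ hR hP B
  set H := R + γ • (Bᵀ * P * B) with hHdef
  have hdet := (Matrix.isUnit_iff_isUnit_det _).1 hH.isUnit
  have hHs := isSymm_of_posSemidef hH.posSemidef
  set g := (Bᵀ * P * A) *ᵥ x with hg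
  set u := F *ᵥ x with hu
  set v := riccatiGain γ A B R P *ᵥ x with hv
  have hHv : H *ᵥ v = -(γ • g) := by
    simp only [hv, riccatiGain, ← hHdef, Matrix.neg_mulVec, Matrix.smul_mulVec, Matrix.mulVec_neg,
      Matrix.mulVec_smul, Matrix.mulVec_mulVec, hg]
    simp only [← Matrix.mul_assoc, Matrix.mul_nonsing_inv _ hdet, Matrix.one_mul]
  have hvg : v = -(γ • (H⁻¹ *ᵥ g)) := by
    simp only [hv, riccatiGain, ← hHdef, Matrix.neg_mulVec, Matrix.smul_mulVec,
      Matrix.mulVec_mulVec, hg]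
    simp only [Matrix.mul_assoc]
  have hr : qf (riccatiOp γ A B Q R P) x = qf Q x + γ * qf P (A *ᵥ x) - γ ^ 2 * qf H⁻¹ g := by
    have e : Aᵀ * P * B = (Bᵀ * P * A)ᵀ := by
      simp [Matrix.mul_assoc, hPs.eq]
    rw [riccatiOp, qf_sub, qf_add, qf_smul, qf_smul, qf_conj, e, qf_conj]
  have hc : (A *ᵥ x) ⬝ᵥ P *ᵥ (B *ᵥ u) = u ⬝ᵥ g := by
    rw [hg, ← Matrix.mulVec_mulVec, ← Matrix.mulVec_mulVec, Matrix.dotProduct_mulVec,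
      ← Matrix.mulVec_transpose, hPs, Matrix.dotProduct_mulVec, ← Matrix.mulVec_transpose,
      dotProduct_comm]
  have hb : bellman γ A B Q R F P x
      = qf Q x + qf R u + γ * (qf P (A *ᵥ x) + 2 * (u ⬝ᵥ g) + qf P (B *ᵥ u)) := by
    rw [bellman, Matrix.add_mulVec, qf_add_right hPs, ← Matrix.mulVec_mulVec, ← hu, hc]
  have hHu : qf H u = qf R u + γ * qf P (B *ᵥ u) := by
    rw [hHdef, qf_add, qf_smul, qf_conj]
  have hHuv : qf H ((F - riccatiGain γ A B R P) *ᵥ x)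
      = qf H u + 2 * γ * (u ⬝ᵥ g) + γ ^ 2 * qf H⁻¹ g := by
    have h1 : qf H v = γ ^ 2 * qf H⁻¹ g := by
      rw [qf, hHv, hvg, qf]
      simp [dotProduct_comm g]; ring
    have h2 : qf H (-v) = qf H v := by
      have := qf_smul_right H (-1) v
      simpa using this
    rw [Matrix.sub_mulVec, ← hu, ← hv, sub_eq_add_neg, qf_add_right hHs, Matrix.mulVec_neg, hHv, h2,
      h1]
    simp; ring
  rw [hb, hr, hHuv, hHu]; ring

lemma qf_riccatiOp_le (hγ : 0 ≤ γ) (hR : R.PosDef) {P : Matrix (Fin n) (Fin n) ℝ}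
    (hP : P.PosSemidef) (F : Matrix (Fin m) (Fin n) ℝ) (x : Fin n → ℝ) :
    qf (riccatiOp γ A B Q R P) x ≤ bellman γ A B Q R F P x := by
  rw [bellman_eq hγ hR hP]
  have := qf_nonneg (posDef_penalty hγ hR hP B).posSemidef ((F - riccatiGain γ A B R P) *ᵥ x)
  linarith

lemma qf_riccatiOp_eq (hγ : 0 ≤ γ) (hR : R.PosDef) {P : Matrix (Fin n) (Fin n) ℝ}
    (hP : P.PosSemidef) (x : Fin n → ℝ) :
    qf (riccatiOp γ A B Q R P) x = bellman γ A B Q R (riccatiGain γ A B R P) P x := by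
  rw [bellman_eq hγ hR hP]; simp [qf_zero_right]

lemma posSemidef_riccatiOp (hγ : 0 ≤ γ) (hQ : Q.PosSemidef) (hR : R.PosDef)
    {P : Matrix (Fin n) (Fin n) ℝ} (hP : P.PosSemidef) :
    (riccatiOp γ A B Q R P).PosSemidef := by
  have hPs := isSymm_of_posSemidef hP
  have hHs := isSymm_of_posSemidef (posDef_penalty hγ hR hP B).posSemidef
  refine posSemidef_of_qf_nonneg ?_ fun x => ?_
  · have := isSymm_of_posSemidef hQ
    simp only [Matrix.IsSymm, riccatiOp, Matrix.transpose_sub, Matrix.transpose_add,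
      Matrix.transpose_smul, Matrix.transpose_mul, Matrix.transpose_transpose, hPs.eq, this.eq,
      Matrix.transpose_nonsing_inv, Matrix.mul_assoc] at hHs ⊢
    rw [hHs]
  · rw [qf_riccatiOp_eq hγ hR hP]
    exact add_nonneg (add_nonneg (qf_nonneg hQ _) (qf_nonneg hR.posSemidef _))
      (mul_nonneg hγ (qf_nonneg hP _))

/-- A minimum of functions monotone in `P` is monotone: test the smaller matrix with the optimal
gain of the larger one. -/
lemma qf_riccatiOp_mono (hγ : 0 ≤ γ) (hR : R.PosDef) {P P' : Matrix (Fin n) (Fin n) ℝ}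
    (hP : P.PosSemidef) (hP' : P'.PosSemidef) (h : ∀ x, qf P x ≤ qf P' x) (x : Fin n → ℝ) :
    qf (riccatiOp γ A B Q R P) x ≤ qf (riccatiOp γ A B Q R P') x := by
  rw [qf_riccatiOp_eq hγ hR hP' x]
  refine (qf_riccatiOp_le hγ hR hP (riccatiGain γ A B R P') x).trans ?_
  unfold bellman
  gcongr
  exact h _

/-- A stabilizing gain gives an upper bound for the value function. -/
lemma exists_bellman_le (Q : Matrix (Fin n) (Fin n) ℝ) (R : Matrix (Fin m) (Fin m) ℝ)
    {K : Matrix (Fin m) (Fin n) ℝ} (hK : LyapunovStable γ (A + B * K)) :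
    ∃ X : Matrix (Fin n) (Fin n) ℝ, X.PosDef ∧ ∀ x, bellman γ A B Q R K X x ≤ qf X x := by
  obtain ⟨X, hX, θ, h0, h1, h⟩ := hK
  obtain ⟨c, hc, hcX⟩ := qf_le_mul_qf (Q + Kᵀ * R * K) hX
  have hθ : 0 < 1 - θ := by linarith
  -- Scaling `X` by `(c + 1) / (1 - θ)` turns its contraction into a loss of `(c + 1) X`, enough to
  -- pay the stage cost, which is at most `c X`.
  refine ⟨((c + 1) / (1 - θ)) • X, hX.smul (by positivity), fun x => ?_⟩
  have h2 := hcX x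
  rw [qf_add, qf_conj] at h2
  have hx := qf_nonneg hX.posSemidef x
  rw [bellman, qf_smul, qf_smul]
  have h3 : (c + 1) / (1 - θ) * (γ * qf X ((A + B * K) *ᵥ x)) ≤
      (c + 1) / (1 - θ) * (θ * qf X x) :=
    mul_le_mul_of_nonneg_left (h x) (by positivity)
  have h4 : (c + 1) / (1 - θ) * qf X x =
      (c + 1) * qf X x + (c + 1) / (1 - θ) * (θ * qf X x) := by
    field_simp; ring
  rw [h4]; linarith

lemma tendsto_riccatiOp (hγ : 0 ≤ γ) (hR : R.PosDef) {P : ℕ → Matrix (Fin n) (Fin n) ℝ}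
    {P₀ : Matrix (Fin n) (Fin n) ℝ} (hP₀ : P₀.PosSemidef) (h : Tendsto P atTop (𝓝 P₀)) :
    Tendsto (fun k => riccatiOp γ A B Q R (P k)) atTop (𝓝 (riccatiOp γ A B Q R P₀)) := by
  have hdet := ((Matrix.isUnit_iff_isUnit_det _).1 (posDef_penalty hγ hR hP₀ B).isUnit).ne_zero
  have hH : Continuous fun P : Matrix (Fin n) (Fin n) ℝ => R + γ • (Bᵀ * P * B) := by fun_prop
  have hinv : ContinuousAt (fun P : Matrix (Fin n) (Fin n) ℝ => (R + γ • (Bᵀ * P * B))⁻¹) P₀ := by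
    have : (fun P : Matrix (Fin n) (Fin n) ℝ => (R + γ • (Bᵀ * P * B))⁻¹) = fun P =>
        (R + γ • (Bᵀ * P * B)).det⁻¹ • (R + γ • (Bᵀ * P * B)).adjugate := by
      ext1 P; rw [Matrix.inv_def, Ring.inverse_eq_inv']
    rw [this]
    exact (hH.matrix_det.continuousAt.inv₀ hdet).smul hH.matrix_adjugate.continuousAt
  have : ContinuousAt (fun P => riccatiOp γ A B Q R P) P₀ := by
    unfold riccatiOp
    refine ContinuousAt.sub (by fun_prop) (ContinuousAt.fun_const_smul ?_ _)
    have h1 : Continuous fun P : Matrix (Fin n) (Fin n) ℝ => Aᵀ * P * B := by fun_prop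
    have h2 : Continuous fun P : Matrix (Fin n) (Fin n) ℝ => Bᵀ * P * A := by fun_prop
    have h3 : Continuous fun p : Matrix (Fin n) (Fin m) ℝ × Matrix (Fin m) (Fin m) ℝ ×
        Matrix (Fin m) (Fin n) ℝ => p.1 * p.2.1 * p.2.2 := by fun_prop
    exact h3.continuousAt.comp
      (f := fun P => (Aᵀ * P * B, (R + γ • (Bᵀ * P * B))⁻¹, Bᵀ * P * A))
      (h1.continuousAt.prodMk (hinv.prodMk h2.continuousAt))
  exact this.tendsto.comp h

/-- Value iteration started at zero converges to a solution of the Riccati equation. -/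
theorem exists_riccatiOp_eq (hγ : 0 ≤ γ) (hQ : Q.PosSemidef) (hR : R.PosDef)
    {K : Matrix (Fin m) (Fin n) ℝ} (hK : LyapunovStable γ (A + B * K)) :
    ∃ P : Matrix (Fin n) (Fin n) ℝ, P.PosSemidef ∧ riccatiOp γ A B Q R P = P := by
  obtain ⟨X, hX, hXb⟩ := exists_bellman_le Q R hK
  set P : ℕ → Matrix (Fin n) (Fin n) ℝ := fun k => (riccatiOp γ A B Q R)^[k] 0 with hPdef
  have hsucc : ∀ k, P (k + 1) = riccatiOp γ A B Q R (P k) := fun k =>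
    Function.iterate_succ_apply' _ _ _
  have hpsd : ∀ k, (P k).PosSemidef := by
    intro k
    induction k with
    | zero => exact .zero
    | succ k ih => rw [hsucc]; exact posSemidef_riccatiOp hγ hQ hR ih
  have hmono : ∀ x, Monotone fun k => qf (P k) x := by
    suffices h : ∀ k x, qf (P k) x ≤ qf (P (k + 1)) x from
      fun x => monotone_nat_of_le_succ fun k => h k x
    intro k
    induction k with
    | zero =>
      intro x
      have : qf (P 0) x = 0 := by simp [hPdef, qf]
      rw [this]; exact qf_nonneg (hpsd _) x
    | succ k ih =>
      intro x
      rw [hsucc k, hsucc (k + 1)]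
      exact qf_riccatiOp_mono hγ hR (hpsd _) (hpsd _) ih x
  -- Each Riccati step is at most the Bellman step with the stabilizing gain `K`, for which `X` is a
  -- supersolution.
  have hbound : ∀ k x, qf (P k) x ≤ qf X x := by
    intro k
    induction k with
    | zero =>
      intro x
      have : qf (P 0) x = 0 := by simp [hPdef, qf]
      rw [this]; exact qf_nonneg hX.posSemidef x
    | succ k ih =>
      intro x
      rw [hsucc]
      refine (qf_riccatiOp_le hγ hR (hpsd k) K x).trans (le_trans ?_ (hXb x))
      unfold bellman
      gcongr
      exact ih _
  obtain ⟨P₀, hP₀⟩ := exists_tendsto_of_monotone_qf (fun k => isSymm_of_posSemidef (hpsd k))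
    hmono hbound
  have hP₀' : P₀.PosSemidef := by
    refine posSemidef_of_qf_nonneg ?_ fun x => ?_
    · refine tendsto_nhds_unique (((continuous_id.matrix_transpose).tendsto P₀).comp hP₀)
        (hP₀.congr fun k => ?_)
      exact (isSymm_of_posSemidef (hpsd k)).symm
    · exact ge_of_tendsto' (((continuous_qf x).tendsto P₀).comp hP₀) fun k => qf_nonneg (hpsd k) x
  refine ⟨P₀, hP₀', tendsto_nhds_unique (tendsto_riccatiOp hγ hR hP₀' hP₀) ?_⟩
  refine ((tendsto_add_atTop_iff_nat 1).2 hP₀).congr fun k => hsucc k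

/-- Detectability turns the stage cost into a Lyapunov supply rate, for every gain. -/
lemma exists_lyapunov_of_detectable (hγ : 0 ≤ γ) (hR : R.PosDef) {C : Matrix (Fin p) (Fin n) ℝ}
    {L : Matrix (Fin n) (Fin p) ℝ} (hL : LyapunovStable γ (A + L * C))
    (F : Matrix (Fin m) (Fin n) ℝ) :
    ∃ X : Matrix (Fin n) (Fin n) ℝ, X.PosDef ∧ ∃ θ c : ℝ, 0 ≤ θ ∧ θ < 1 ∧ 0 ≤ c ∧
      ∀ x, γ * qf X ((A + B * F) *ᵥ x) ≤
        θ * qf X x + c * (qf (Cᵀ * C) x + qf R (F *ᵥ x)) := by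
  obtain ⟨X, hX, θ, h0, h1, h⟩ := hL
  obtain ⟨c₁, hc₁, h₁⟩ := qf_le_mul_qf (Bᵀ * X * B) hR
  obtain ⟨c₂, hc₂, h₂⟩ := qf_le_mul_qf ((-L)ᵀ * X * -L) (Matrix.PosDef.one (n := Fin p) (R := ℝ))
  -- This `ε` keeps `(1 + ε) θ < 1`, so the cross terms from Young's inequality do not destroy the
  -- contraction.
  set ε := (1 - θ) / 2 with hε
  have hε0 : 0 < ε := by rw [hε]; linarith
  set k := γ * (1 + 1 / ε) with hk
  have hk0 : 0 ≤ k := by positivity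
  refine ⟨X, hX, (1 + ε) * θ, k * (2 * (c₁ + c₂)), by positivity, by rw [hε]; nlinarith,
    by positivity, fun x => ?_⟩
  -- Output injection: the closed loop is the stable matrix `A + L C` perturbed by terms in the
  -- input `F x` and the output `C x`, both paid for by the stage cost.
  have e : (A + B * F) *ᵥ x = (A + L * C) *ᵥ x + (B *ᵥ (F *ᵥ x) + (-L) *ᵥ (C *ᵥ x)) := by
    simp only [Matrix.add_mulVec, Matrix.mulVec_mulVec, Matrix.neg_mulVec, Matrix.neg_mul]; abel
  have i1 := qf_add_le hX.posSemidef hε0 ((A + L * C) *ᵥ x) (B *ᵥ (F *ᵥ x) + (-L) *ᵥ (C *ᵥ x))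
  have i2 := qf_add_le hX.posSemidef one_pos (B *ᵥ (F *ᵥ x)) ((-L) *ᵥ (C *ᵥ x))
  have i3 := h₁ (F *ᵥ x)
  have i4 := h₂ (C *ᵥ x)
  rw [qf_conj] at i3 i4
  rw [← qf_transpose_mul_self] at i4
  have n1 := qf_nonneg hR.posSemidef (F *ᵥ x)
  have n2 : 0 ≤ qf (Cᵀ * C) x := by rw [qf_transpose_mul_self]; exact qf_nonneg .one _
  have i5 : qf X (B *ᵥ (F *ᵥ x) + (-L) *ᵥ (C *ᵥ x)) ≤
      2 * (c₁ + c₂) * (qf (Cᵀ * C) x + qf R (F *ᵥ x)) := by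
    have := mul_nonneg hc₁ n2
    have := mul_nonneg hc₂ n1
    rw [show (1 : ℝ) + 1 / 1 = 2 by norm_num, show (1 : ℝ) + 1 = 2 by norm_num] at i2
    linarith
  rw [e]
  calc _ ≤ γ * ((1 + ε) * qf X ((A + L * C) *ᵥ x) +
        (1 + 1 / ε) * (2 * (c₁ + c₂) * (qf (Cᵀ * C) x + qf R (F *ᵥ x)))) := by
        refine mul_le_mul_of_nonneg_left (i1.trans ?_) hγ
        gcongr
    _ = (1 + ε) * (γ * qf X ((A + L * C) *ᵥ x)) +
        k * (2 * (c₁ + c₂)) * (qf (Cᵀ * C) x + qf R (F *ᵥ x)) := by rw [hk]; ring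
    _ ≤ (1 + ε) * (θ * qf X x) + k * (2 * (c₁ + c₂)) * (qf (Cᵀ * C) x + qf R (F *ᵥ x)) := by
        gcongr (1 + ε) * ?_ + _
        exact h x
    _ = _ := by ring

/-- The Lyapunov function is `X + c P`: along the closed loop the discounted value `c P` loses
exactly `c` times the stage cost, cancelling the supply term of `exists_lyapunov_of_detectable`.
What remains is a loss `(1 - θ) X`, comparable to `X + c P` because `c P ≤ k X`. -/
lemma lyapunovStable_riccatiGain (hγ : 0 ≤ γ) (hR : R.PosDef)
    {C : Matrix (Fin p) (Fin n) ℝ} (hC : Cᵀ * C = Q) {L : Matrix (Fin n) (Fin p) ℝ}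
    (hL : LyapunovStable γ (A + L * C)) {P : Matrix (Fin n) (Fin n) ℝ} (hP : P.PosSemidef)
    (h : riccatiOp γ A B Q R P = P) : LyapunovStable γ (A + B * riccatiGain γ A B R P) := by
  obtain ⟨X, hX, θ, c, h0, h1, hc, hx⟩ :=
    exists_lyapunov_of_detectable (B := B) hγ hR hL (riccatiGain γ A B R P)
  obtain ⟨k, hk, hkP⟩ := qf_le_mul_qf (c • P) hX
  have hδ : (1 - θ) / (1 + k) ≤ 1 := by rw [div_le_one (by positivity)]; linarith
  have hδ0 : 0 < (1 - θ) / (1 + k) := div_pos (by linarith) (by positivity)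
  refine ⟨X + c • P, hX.add_posSemidef (hP.smul hc), 1 - (1 - θ) / (1 + k), by linarith,
    by linarith, fun x => ?_⟩
  have e := qf_riccatiOp_eq (A := A) (B := B) (Q := Q) hγ hR hP x
  rw [h, bellman] at e
  have i1 := hx x
  have i2 := hkP x
  rw [hC] at i1
  rw [qf_smul] at i2
  rw [qf_add, qf_add, qf_smul, qf_smul]
  have i3 : (1 - θ) / (1 + k) * (qf X x + c * qf P x) ≤ (1 - θ) * qf X x := by
    rw [div_mul_eq_mul_div, div_le_iff₀ (by positivity), mul_assoc]
    refine mul_le_mul_of_nonneg_left ?_ (by linarith)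
    linarith
  have i4 := congrArg (c * ·) e
  beta_reduce at i4
  linarith

/-- Iterating the hypothesis gives `D(x) ≤ γ^k D(M^k x) ≤ c θ^k Y(x)`, which tends to zero. -/
lemma qf_nonpos_of_le (hγ : 0 ≤ γ) {M D : Matrix (Fin n) (Fin n) ℝ} (hM : LyapunovStable γ M)
    (hD : ∀ x, qf D x ≤ γ * qf D (M *ᵥ x)) (x : Fin n → ℝ) : qf D x ≤ 0 := by
  obtain ⟨Y, hY, θ, h0, h1, hx⟩ := hM
  obtain ⟨c, hc, hcY⟩ := qf_le_mul_qf D hY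
  have hk : ∀ k : ℕ, ∀ x, qf D x ≤ c * (θ ^ k * qf Y x) := by
    intro k
    induction k with
    | zero => simpa using hcY
    | succ k ih =>
      intro x
      calc _ ≤ γ * qf D (M *ᵥ x) := hD x
        _ ≤ γ * (c * (θ ^ k * qf Y (M *ᵥ x))) := by gcongr; exact ih _
        _ = c * (θ ^ k * (γ * qf Y (M *ᵥ x))) := by ring
        _ ≤ c * (θ ^ k * (θ * qf Y x)) :=
          mul_le_mul_of_nonneg_left (mul_le_mul_of_nonneg_left (hx x) (by positivity)) hc
        _ = _ := by ring
  have hlim : Tendsto (fun k : ℕ => c * (θ ^ k * qf Y x)) atTop (𝓝 0) := by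
    simpa using ((tendsto_pow_atTop_nhds_zero_of_lt_one h0 h1).mul_const (qf Y x)).const_mul c
  exact ge_of_tendsto' hlim fun k => hk k x

/-- Comparison with a solution of the Riccati equation. -/
theorem qf_le_of_le_bellman (hγ : 0 ≤ γ) (hR : R.PosDef)
    {C : Matrix (Fin p) (Fin n) ℝ} (hC : Cᵀ * C = Q) {L : Matrix (Fin n) (Fin p) ℝ}
    (hL : LyapunovStable γ (A + L * C)) {P : Matrix (Fin n) (Fin n) ℝ} (hP : P.PosSemidef)
    (h : riccatiOp γ A B Q R P = P) {Z : Matrix (Fin n) (Fin n) ℝ}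
    (hZ : ∀ x, qf Z x ≤ bellman γ A B Q R (riccatiGain γ A B R P) Z x) (x : Fin n → ℝ) :
    qf Z x ≤ qf P x := by
  -- Under the gain of `P`, the Bellman relation is an equality for `P` and an inequality for `Z`;
  -- subtracting cancels the stage cost.
  have := qf_nonpos_of_le hγ (lyapunovStable_riccatiGain hγ hR hC hL hP h) (D := Z - P)
    (fun y => ?_) x
  · rw [qf_sub] at this
    linarith
  · have e := qf_riccatiOp_eq (A := A) (B := B) (Q := Q) hγ hR hP y
    have := hZ y
    rw [h, bellman] at e
    rw [bellman] at this
    rw [qf_sub, qf_sub]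
    linarith

/-- Each solution is a subsolution for every gain, in particular for the other's, so the comparison
applies both ways. -/
theorem riccatiOp_eq_unique (hγ : 0 ≤ γ) (hR : R.PosDef)
    {C : Matrix (Fin p) (Fin n) ℝ} (hC : Cᵀ * C = Q) {L : Matrix (Fin n) (Fin p) ℝ}
    (hL : LyapunovStable γ (A + L * C)) {P P' : Matrix (Fin n) (Fin n) ℝ} (hP : P.PosSemidef)
    (hP' : P'.PosSemidef) (h : riccatiOp γ A B Q R P = P) (h' : riccatiOp γ A B Q R P' = P') :
    P = P' := by
  refine eq_of_qf_eq (isSymm_of_posSemidef hP) (isSymm_of_posSemidef hP') fun x =>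
    le_antisymm (qf_le_of_le_bellman hγ hR hC hL hP' h' (fun y => ?_) x)
      (qf_le_of_le_bellman hγ hR hC hL hP h (fun y => ?_) x)
  · have := qf_riccatiOp_le (A := A) (B := B) (Q := Q) hγ hR hP (riccatiGain γ A B R P') y
    rwa [h] at this
  · have := qf_riccatiOp_le (A := A) (B := B) (Q := Q) hγ hR hP' (riccatiGain γ A B R P) y
    rwa [h'] at this

lemma posDef_of_riccatiOp_eq (hγ : 0 ≤ γ) (hQ : Q.PosDef) (hR : R.PosDef)
    {P : Matrix (Fin n) (Fin n) ℝ} (hP : P.PosSemidef) (h : riccatiOp γ A B Q R P = P) :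
    P.PosDef := by
  refine posDef_of_qf_pos (isSymm_of_posSemidef hP) fun x hx => ?_
  have e := qf_riccatiOp_eq (A := A) (B := B) (Q := Q) hγ hR hP x
  rw [h, bellman] at e
  rw [e]
  have := mul_nonneg hγ (qf_nonneg hP ((A + B * riccatiGain γ A B R P) *ᵥ x))
  linarith [qf_pos hQ hx, qf_nonneg hR.posSemidef (riccatiGain γ A B R P *ᵥ x)]

end Riccati

/-! ### Dependence on a scalar control penalty -/

section ScalarPenalty

variable {n m p : ℕ} {γ : ℝ} {A : Matrix (Fin n) (Fin n) ℝ} {B : Matrix (Fin n) (Fin m) ℝ}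
  {Q : Matrix (Fin n) (Fin n) ℝ} {R : Matrix (Fin m) (Fin m) ℝ}

/-- Evaluated at a basis vector, the form controls the square of every entry of the corresponding
column. -/
lemma tendsto_zero_of_qf {ι : Type*} {l : Filter ι} (hR : R.PosDef)
    {F : ι → Matrix (Fin m) (Fin n) ℝ}
    (h : ∀ x, Tendsto (fun i => qf R (F i *ᵥ x)) l (𝓝 0)) : Tendsto F l (𝓝 0) := by
  obtain ⟨c, hc, hcR⟩ := qf_one_le_mul_qf hR
  refine tendsto_pi_nhds.2 fun i => tendsto_pi_nhds.2 fun j => ?_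
  have h1 : Tendsto (fun k => √(c * qf R (F k *ᵥ Pi.single j 1))) l (𝓝 0) := by
    simpa using ((h (Pi.single j 1)).const_mul c).sqrt
  refine squeeze_zero_norm (fun k => ?_) h1
  refine Real.le_sqrt_of_sq_le (le_trans ?_ (hcR _))
  rw [qf_one, Real.norm_eq_abs, sq_abs]
  refine le_trans (le_of_eq ?_) (Finset.single_le_sum
    (f := fun a => ((F k *ᵥ Pi.single j 1) a) ^ 2) (fun _ _ => sq_nonneg _) (Finset.mem_univ i))
  simp

variable {P : ℝ → Matrix (Fin n) (Fin n) ℝ}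

/-- Raising the penalty raises the one-step cost, so `P s` is a subsolution of the problem with
penalty `t ≥ s`. -/
lemma qf_monotoneOn (hγ : 0 ≤ γ) (hR : R.PosDef)
    {C : Matrix (Fin p) (Fin n) ℝ} (hC : Cᵀ * C = Q) {L : Matrix (Fin n) (Fin p) ℝ}
    (hL : LyapunovStable γ (A + L * C)) (hP : ∀ s, 0 < s → (P s).PosSemidef)
    (hE : ∀ s, 0 < s → riccatiOp γ A B Q (s • R) (P s) = P s) (x : Fin n → ℝ) :
    MonotoneOn (fun s => qf (P s) x) (Set.Ioi 0) := by
  intro s hs t ht hst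
  rw [Set.mem_Ioi] at hs ht
  refine qf_le_of_le_bellman hγ (hR.smul ht) hC hL (hP t ht) (hE t ht) (fun y => ?_) x
  have h := qf_riccatiOp_le (A := A) (B := B) (Q := Q) hγ (hR.smul hs) (hP s hs)
    (riccatiGain γ A B (t • R) (P t)) y
  rw [hE s hs] at h
  refine h.trans ?_
  unfold bellman
  rw [qf_smul, qf_smul]
  have := qf_nonneg hR.posSemidef (riccatiGain γ A B (t • R) (P t) *ᵥ y)
  gcongr

/-- For a fixed gain the one-step cost is jointly affine in the penalty and the terminal cost. A
convex combination of solutions is therefore a subsolution for the combined penalty. -/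
lemma qf_concaveOn (hγ : 0 ≤ γ) (hR : R.PosDef)
    {C : Matrix (Fin p) (Fin n) ℝ} (hC : Cᵀ * C = Q) {L : Matrix (Fin n) (Fin p) ℝ}
    (hL : LyapunovStable γ (A + L * C)) (hP : ∀ s, 0 < s → (P s).PosSemidef)
    (hE : ∀ s, 0 < s → riccatiOp γ A B Q (s • R) (P s) = P s) (x : Fin n → ℝ) :
    ConcaveOn ℝ (Set.Ioi 0) (fun s => qf (P s) x) := by
  refine ⟨convex_Ioi 0, fun s hs t ht a b ha hb hab => ?_⟩
  have hu := convex_Ioi (0 : ℝ) hs ht ha hb hab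
  simp only [smul_eq_mul, Set.mem_Ioi] at hs ht hu ⊢
  rw [← qf_smul, ← qf_smul, ← qf_add]
  refine qf_le_of_le_bellman hγ (hR.smul hu) hC hL (hP _ hu) (hE _ hu) (fun y => ?_) x
  set F := riccatiGain γ A B ((a * s + b * t) • R) (P (a * s + b * t))
  have h1 := qf_riccatiOp_le (A := A) (B := B) (Q := Q) hγ (hR.smul hs) (hP s hs) F y
  have h2 := qf_riccatiOp_le (A := A) (B := B) (Q := Q) hγ (hR.smul ht) (hP t ht) F y
  rw [hE s hs] at h1
  rw [hE t ht] at h2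
  have e : bellman γ A B Q ((a * s + b * t) • R) F (a • P s + b • P t) y =
      a * bellman γ A B Q (s • R) F (P s) y + b * bellman γ A B Q (t • R) F (P t) y := by
    simp only [bellman, qf_smul, qf_add]
    linear_combination (-qf Q y) * hab
  rw [e, qf_add, qf_smul, qf_smul]
  gcongr

/-- Using the gain of `t` in the problem of `s` costs at most `P t`, by monotonicity, and exceeds
the optimum `P s` by the completed square; its part involving `B` is dropped. -/
lemma mul_qf_gain_sub_le (hγ : 0 ≤ γ) (hR : R.PosDef)
    {C : Matrix (Fin p) (Fin n) ℝ} (hC : Cᵀ * C = Q) {L : Matrix (Fin n) (Fin p) ℝ}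
    (hL : LyapunovStable γ (A + L * C)) (hP : ∀ s, 0 < s → (P s).PosSemidef)
    (hE : ∀ s, 0 < s → riccatiOp γ A B Q (s • R) (P s) = P s) {s t : ℝ} (hs : 0 < s)
    (hst : s ≤ t) (x : Fin n → ℝ) :
    s * qf R ((riccatiGain γ A B (t • R) (P t) - riccatiGain γ A B (s • R) (P s)) *ᵥ x) ≤
      qf (P t) x - qf (P s) x := by
  have ht := hs.trans_le hst
  have h1 := bellman_eq (A := A) (B := B) (Q := Q) hγ (hR.smul hs) (hP s hs)
    (riccatiGain γ A B (t • R) (P t)) x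
  have h2 := qf_riccatiOp_eq (A := A) (B := B) (Q := Q) hγ (hR.smul ht) (hP t ht) x
  rw [hE s hs, qf_add, qf_smul, qf_smul, qf_conj] at h1
  rw [hE t ht] at h2
  have h3 := mul_nonneg hγ (qf_nonneg (hP s hs)
    (B *ᵥ ((riccatiGain γ A B (t • R) (P t) - riccatiGain γ A B (s • R) (P s)) *ᵥ x)))
  have h4 : bellman γ A B Q (s • R) (riccatiGain γ A B (t • R) (P t)) (P s) x ≤
      bellman γ A B Q (t • R) (riccatiGain γ A B (t • R) (P t)) (P t) x := by
    unfold bellman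
    rw [qf_smul, qf_smul]
    have := qf_nonneg hR.posSemidef (riccatiGain γ A B (t • R) (P t) *ᵥ x)
    gcongr
    exact qf_monotoneOn hγ hR hC hL hP hE _ hs ht hst
  linarith

/-- The gain is left-continuous in the penalty at `1`. -/
theorem tendsto_gain_one (hγ : 0 ≤ γ) (hR : R.PosDef)
    {C : Matrix (Fin p) (Fin n) ℝ} (hC : Cᵀ * C = Q) {L : Matrix (Fin n) (Fin p) ℝ}
    (hL : LyapunovStable γ (A + L * C)) (hP : ∀ s, 0 < s → (P s).PosSemidef)
    (hE : ∀ s, 0 < s → riccatiOp γ A B Q (s • R) (P s) = P s) :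
    Tendsto (fun ρ : ℝ => riccatiGain γ A B ((ρ + 1)⁻¹ • R) (P (ρ + 1)⁻¹)) (𝓝[>] 0)
      (𝓝 (riccatiGain γ A B ((1 : ℝ) • R) (P 1))) := by
  have hs : Tendsto (fun ρ : ℝ => (ρ + 1)⁻¹) (𝓝[>] 0) (𝓝 1) := by
    have : ContinuousAt (fun ρ : ℝ => (ρ + 1)⁻¹) 0 := by
      refine ContinuousAt.inv₀ (by fun_prop) (by norm_num)
    simpa using this.tendsto.mono_left nhdsWithin_le_nhds
  have key : Tendsto (fun ρ : ℝ => riccatiGain γ A B ((1 : ℝ) • R) (P 1) -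
      riccatiGain γ A B ((ρ + 1)⁻¹ • R) (P (ρ + 1)⁻¹)) (𝓝[>] 0) (𝓝 0) := by
    refine tendsto_zero_of_qf hR fun x => ?_
    -- A concave function on an open interval is continuous, so no perturbation theory of the
    -- Riccati equation is needed.
    have hc : ContinuousAt (fun s => qf (P s) x) 1 :=
      ((qf_concaveOn hγ hR hC hL hP hE x).continuousOn isOpen_Ioi).continuousAt
        (isOpen_Ioi.mem_nhds (by simp))
    have hlim : Tendsto (fun ρ : ℝ => (ρ + 1) * (qf (P 1) x - qf (P (ρ + 1)⁻¹) x)) (𝓝[>] 0)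
        (𝓝 ((0 + 1) * (qf (P 1) x - qf (P 1) x))) := by
      refine Tendsto.mul ?_ (tendsto_const_nhds.sub (hc.tendsto.comp hs))
      exact ((continuous_id.add continuous_const).tendsto 0).mono_left nhdsWithin_le_nhds
    rw [sub_self, mul_zero] at hlim
    refine tendsto_of_tendsto_of_tendsto_of_le_of_le' tendsto_const_nhds hlim
      (Eventually.of_forall fun ρ => qf_nonneg hR.posSemidef _) ?_
    filter_upwards [self_mem_nhdsWithin] with ρ hρ
    have hρ' : 0 < ρ + 1 := by linarith [Set.mem_Ioi.1 hρ]
    have := mul_qf_gain_sub_le hγ hR hC hL hP hE (inv_pos.2 hρ')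
      (inv_le_one_of_one_le₀ (by linarith [Set.mem_Ioi.1 hρ])) x
    rwa [inv_mul_le_iff₀ hρ'] at this
  simpa using (tendsto_const_nhds (x := riccatiGain γ A B ((1 : ℝ) • R) (P 1))).sub key

/-- For a vanishing penalty, the gains of two asymptotically equal penalties merge. -/
theorem tendsto_gain_sub_zero (hγ : 0 ≤ γ) (hR : R.PosDef)
    {C : Matrix (Fin p) (Fin n) ℝ} (hC : Cᵀ * C = Q) {L : Matrix (Fin n) (Fin p) ℝ}
    (hL : LyapunovStable γ (A + L * C)) (hP : ∀ s, 0 < s → (P s).PosSemidef)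
    (hE : ∀ s, 0 < s → riccatiOp γ A B Q (s • R) (P s) = P s) :
    Tendsto (fun ρ : ℝ => riccatiGain γ A B ((ρ + 1)⁻¹ • R) (P (ρ + 1)⁻¹) -
      riccatiGain γ A B (ρ⁻¹ • R) (P ρ⁻¹)) atTop (𝓝 0) := by
  suffices key : Tendsto (fun ρ : ℝ => riccatiGain γ A B (ρ⁻¹ • R) (P ρ⁻¹) -
      riccatiGain γ A B ((ρ + 1)⁻¹ • R) (P (ρ + 1)⁻¹)) atTop (𝓝 0) by
    simpa using key.neg
  refine tendsto_zero_of_qf hR fun x => ?_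
  set f : ℝ → ℝ := fun s => qf (P s) x with hf
  have hmono : MonotoneOn f (Set.Ioi 0) := qf_monotoneOn hγ hR hC hL hP hE x
  have hconc : ConcaveOn ℝ (Set.Ioi 0) f := qf_concaveOn hγ hR hC hL hP hE x
  -- The value is monotone and bounded below by zero, hence has a limit as the penalty vanishes.
  obtain ⟨l, hl⟩ : ∃ l, Tendsto f (𝓝[>] 0) (𝓝 l) :=
    ⟨_, hmono.tendsto_nhdsGT ⟨0, by
      rintro _ ⟨s, hs, rfl⟩; exact qf_nonneg (hP s hs) x⟩⟩
  -- Concavity at `r < s < t`, with `r` sent to zero: the chord slope beyond `s` is at most `(f s -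
  -- l) / s`.
  have hslope : ∀ s t, 0 < s → s < t → (f t - f s) * s ≤ (f s - l) * (t - s) := by
    intro s t hs hst
    have h1 : Tendsto (fun r => (f t - f s) * (s - r)) (𝓝[>] 0) (𝓝 ((f t - f s) * (s - 0))) :=
      (Continuous.tendsto (by fun_prop) 0).mono_left nhdsWithin_le_nhds
    have h2 : Tendsto (fun r => (f s - f r) * (t - s)) (𝓝[>] 0) (𝓝 ((f s - l) * (t - s))) :=
      (tendsto_const_nhds.sub hl).mul_const _
    rw [sub_zero] at h1
    refine le_of_tendsto_of_tendsto h1 h2 ?_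
    filter_upwards [Ioo_mem_nhdsGT hs] with r hr
    have := hconc.slope_anti_adjacent (Set.mem_Ioi.2 hr.1) (Set.mem_Ioi.2 (hs.trans hst)) hr.2 hst
    rwa [div_le_div_iff₀ (by linarith) (by linarith [hr.2])] at this
  have hs0 : Tendsto (fun ρ : ℝ => (ρ + 1)⁻¹) atTop (𝓝[>] 0) :=
    tendsto_inv_atTop_nhdsGT_zero.comp (tendsto_atTop_add_const_right _ _ tendsto_id)
  have hlim : Tendsto (fun ρ : ℝ => (1 + ρ⁻¹) * (f (ρ + 1)⁻¹ - l)) atTop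
      (𝓝 ((1 + 0) * (l - l))) :=
    (tendsto_const_nhds.add tendsto_inv_atTop_zero).mul ((hl.comp hs0).sub tendsto_const_nhds)
  rw [sub_self, mul_zero] at hlim
  refine tendsto_of_tendsto_of_tendsto_of_le_of_le' tendsto_const_nhds hlim
    (Eventually.of_forall fun ρ => qf_nonneg hR.posSemidef _) ?_
  filter_upwards [eventually_gt_atTop 0] with ρ hρ
  have hρ' : 0 < ρ + 1 := by linarith
  have hlt : (ρ + 1)⁻¹ < ρ⁻¹ := inv_strictAnti₀ hρ (by linarith)
  have h1 := mul_qf_gain_sub_le hγ hR hC hL hP hE (inv_pos.2 hρ') hlt.le x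
  have h2 := hslope _ _ (inv_pos.2 hρ') hlt
  rw [inv_mul_le_iff₀ hρ'] at h1
  -- As `1/ρ - 1/(ρ+1) = (1/ρ) (1/(ρ+1))`, the slope bound gains a factor `1/ρ` that absorbs the
  -- factor `ρ + 1` in `h1`.
  have h3 : f ρ⁻¹ - f (ρ + 1)⁻¹ ≤ (f (ρ + 1)⁻¹ - l) * ρ⁻¹ := by
    have e : (f (ρ + 1)⁻¹ - l) * (ρ⁻¹ - (ρ + 1)⁻¹) =
        ((f (ρ + 1)⁻¹ - l) * ρ⁻¹) * (ρ + 1)⁻¹ := by field_simp; ring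
    rw [e] at h2
    exact le_of_mul_le_mul_right h2 (inv_pos.2 hρ')
  refine h1.trans ?_
  calc (ρ + 1) * (f ρ⁻¹ - f (ρ + 1)⁻¹) ≤ (ρ + 1) * ((f (ρ + 1)⁻¹ - l) * ρ⁻¹) := by gcongr
    _ = _ := by field_simp

/-- An expensive control is not used if the free system is stable. -/
theorem tendsto_gain_zero (hγ : 0 ≤ γ) (hR : R.PosDef) (hA : LyapunovStable γ A)
    (hQ : Q.PosSemidef) (hP : ∀ s, 0 < s → (P s).PosSemidef)
    (hE : ∀ s, 0 < s → riccatiOp γ A B Q (s • R) (P s) = P s) :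
    Tendsto (fun ρ : ℝ => riccatiGain γ A B (ρ⁻¹ • R) (P ρ⁻¹)) (𝓝[>] 0) (𝓝 0) := by
  have hA' : LyapunovStable γ (A + B * (0 : Matrix (Fin m) (Fin n) ℝ)) := by simpa using hA
  -- With zero control the penalty plays no role, so this `X` bounds all the values `P s`
  -- simultaneously.
  obtain ⟨X, hX, hXb⟩ := exists_bellman_le Q (0 : Matrix (Fin m) (Fin m) ℝ) hA'
  have hle : ∀ s, 0 < s → ∀ x, qf (P s) x ≤ qf X x := by
    intro s hs x
    have := qf_nonpos_of_le hγ hA' (D := P s - X) (fun y => ?_) x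
    · rw [qf_sub] at this; linarith
    · have h1 := qf_riccatiOp_le (A := A) (B := B) (Q := Q) hγ (hR.smul hs) (hP s hs)
        (0 : Matrix (Fin m) (Fin n) ℝ) y
      have h2 := hXb y
      rw [hE s hs] at h1
      simp only [bellman, Matrix.zero_mulVec, qf_zero_right] at h1 h2
      rw [qf_sub, qf_sub]
      linarith
  refine tendsto_zero_of_qf hR fun x => ?_
  have hlim : Tendsto (fun ρ : ℝ => ρ * qf X x) (𝓝[>] 0) (𝓝 (0 * qf X x)) :=
    (tendsto_id.mono_left nhdsWithin_le_nhds).mul_const _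
  rw [zero_mul] at hlim
  refine tendsto_of_tendsto_of_tendsto_of_le_of_le' tendsto_const_nhds hlim
    (Eventually.of_forall fun ρ => qf_nonneg hR.posSemidef _) ?_
  filter_upwards [self_mem_nhdsWithin] with ρ hρ
  have hs := inv_pos.2 (Set.mem_Ioi.1 hρ)
  have h1 := qf_riccatiOp_eq (A := A) (B := B) (Q := Q) hγ (hR.smul hs) (hP _ hs) x
  rw [hE _ hs, bellman, qf_smul] at h1
  have h2 := hle _ hs x
  have h3 := qf_nonneg hQ x
  have h4 := mul_nonneg hγ (qf_nonneg (hP _ hs)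
    ((A + B * riccatiGain γ A B (ρ⁻¹ • R) (P ρ⁻¹)) *ᵥ x))
  have h5 : ρ⁻¹ * qf R (riccatiGain γ A B (ρ⁻¹ • R) (P ρ⁻¹) *ᵥ x) ≤ qf X x := by linarith
  rwa [inv_mul_le_iff₀ (Set.mem_Ioi.1 hρ)] at h5

end ScalarPenalty

/-! ### Gaussian measures and the Kullback-Leibler divergence -/

section Gaussian

variable {n m : ℕ}

lemma ofLp_act (M : Matrix (Fin n) (Fin m) ℝ) (x : Euc m) : (act M x).ofLp = M *ᵥ x.ofLp := rfl

lemma act_eq (M : Matrix (Fin n) (Fin m) ℝ) (x : Euc m) : act M x = WithLp.toLp 2 (M *ᵥ x.ofLp) :=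
  rfl

@[fun_prop]
lemma continuous_act (M : Matrix (Fin n) (Fin m) ℝ) : Continuous (act M) :=
  (Matrix.toEuclideanLin M).continuous_of_finiteDimensional

lemma inner_eq_dotProduct (x y : Euc n) : inner ℝ x y = x.ofLp ⬝ᵥ y.ofLp := by
  rw [EuclideanSpace.inner_eq_star_dotProduct, dotProduct_comm]; simp

lemma inner_act_self (M : Matrix (Fin n) (Fin n) ℝ) (x : Euc n) :
    inner ℝ x (act M x) = qf M x.ofLp := by
  rw [inner_eq_dotProduct, ofLp_act, qf]

variable {S : Matrix (Fin n) (Fin n) ℝ}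

lemma map_inner_multivariateGaussian (hS : S.PosSemidef) (a v : Euc n) :
    (multivariateGaussian a S).map (fun x => inner ℝ v x) =
      gaussianReal (inner ℝ v a) (qf S v.ofLp).toNNReal := by
  have h := IsGaussian.map_eq_gaussianReal (μ := multivariateGaussian a S) (innerSL ℝ v)
  have h1 : (multivariateGaussian a S)[innerSL ℝ v] = inner ℝ v a := by
    rw [IsGaussian.integral_dual, integral_id_multivariateGaussian, innerSL_apply_apply]
  have h2 : Var[innerSL ℝ v; multivariateGaussian a S] = qf S v.ofLp := by
    rw [qf, ← covarianceBilin_multivariateGaussian (μ := a) hS,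
      covarianceBilin_self IsGaussian.memLp_two_id]
    rfl
  rw [h1, h2] at h
  exact h

lemma integrable_exp_inner (hS : S.PosSemidef) (a v : Euc n) :
    Integrable (fun x => Real.exp (inner ℝ v x)) (multivariateGaussian a S) := by
  have h := integrable_exp_mul_gaussianReal (μ := inner ℝ v a) (v := (qf S v.ofLp).toNNReal) 1
  rw [← map_inner_multivariateGaussian hS, integrable_map_measure (by fun_prop) (by fun_prop)] at h
  simpa [Function.comp_def] using h

lemma integral_exp_inner (hS : S.PosSemidef) (a v : Euc n) :
    ∫ x, Real.exp (inner ℝ v x) ∂(multivariateGaussian a S) =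
      Real.exp (inner ℝ v a + qf S v.ofLp / 2) := by
  have h := mgf_gaussianReal (map_inner_multivariateGaussian hS a v) 1
  simpa [mgf, Real.coe_toNNReal _ (qf_nonneg hS _)] using h

lemma integrable_inner (a v : Euc n) :
    Integrable (fun x => inner ℝ v x) (multivariateGaussian a S) :=
  IsGaussian.integrable_dual (multivariateGaussian a S) (innerSL ℝ v)

lemma integral_inner (a v : Euc n) :
    ∫ x, inner ℝ v x ∂(multivariateGaussian a S) = inner ℝ v a := by
  have := IsGaussian.integral_dual (μ := multivariateGaussian a S) (innerSL ℝ v)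
  simpa using this

/-- By analytic continuation, everywhere finite Laplace transforms determine the law of each
projection `⟨v, x⟩`; the projections determine the characteristic function. -/
lemma eq_of_integral_exp_inner_eq {μ ν : Measure (Euc n)} [IsProbabilityMeasure μ]
    [IsProbabilityMeasure ν] (hint : ∀ v : Euc n, Integrable (fun x => Real.exp (inner ℝ v x)) μ)
    (h : ∀ v : Euc n, ∫ x, Real.exp (inner ℝ v x) ∂μ = ∫ x, Real.exp (inner ℝ v x) ∂ν) :
    μ = ν := by
  have hm : ∀ v : Euc n, mgf (fun x => inner ℝ v x) μ = mgf (fun x => inner ℝ v x) ν := fun v => by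
    ext t
    simpa [mgf, inner_smul_left] using h (t • v)
  have hu : ∀ v : Euc n, integrableExpSet (fun x => inner ℝ v x) μ = Set.univ := fun v => by
    ext t
    simpa [integrableExpSet, inner_smul_left] using hint (t • v)
  have hmap : ∀ v : Euc n, μ.map (fun x => inner ℝ v x) = ν.map (fun x => inner ℝ v x) := by
    intro v
    refine Measure.ext_of_complexMGF_eq (by fun_prop) (by fun_prop) ?_
    ext z
    refine eqOn_complexMGF_of_mgf (hm v) ?_
    simp [hu v]
  refine Measure.ext_of_charFun ?_
  ext v
  have e : ∀ (ρ : Measure (Euc n)), charFun ρ v = charFun (ρ.map fun x => inner ℝ v x) 1 := by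
    intro ρ
    rw [charFun_apply, charFun_apply_real, integral_map (by fun_prop) (by fun_prop)]
    simp [real_inner_comm]
  rw [e, e, hmap]

/-- The **Cameron-Martin** formula for nondegenerate Gaussian measures. -/
lemma multivariateGaussian_tilted (hS : S.PosDef) (a h : Euc n) :
    (multivariateGaussian a S).tilted (fun x => inner ℝ (act S⁻¹ h) x) =
      multivariateGaussian (a + h) S := by
  set η := act S⁻¹ h with hη
  have hps := hS.posSemidef
  have hdet := (Matrix.isUnit_iff_isUnit_det _).1 hS.isUnit
  have := isProbabilityMeasure_tilted (integrable_exp_inner hps a η)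
  have e : ∀ v x : Euc n, Real.exp (inner ℝ η x) * Real.exp (inner ℝ v x) =
      Real.exp (inner ℝ (η + v) x) := fun v x => by rw [inner_add_left, Real.exp_add]
  refine eq_of_integral_exp_inner_eq (fun v => ?_) fun v => ?_
  · rw [integrable_tilted_iff (integrable_exp_inner hps a η)]
    simpa [e] using integrable_exp_inner hps a (η + v)
  · rw [integral_exp_tilted]
    have e2 : ∀ x : Euc n, ((fun x => inner ℝ η x) + fun x => inner ℝ v x) x = inner ℝ (η + v) x :=
      fun x => by rw [inner_add_left]; rfl
    simp only [e2]
    rw [integral_exp_inner hps, integral_exp_inner hps, integral_exp_inner hps, ← Real.exp_sub]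
    congr 1
    have hq : qf S (η + v).ofLp = qf S η.ofLp + 2 * inner ℝ v h + qf S v.ofLp := by
      rw [add_comm η v, WithLp.ofLp_add, qf_add_right (isSymm_of_posSemidef hps),
        inner_eq_dotProduct v h, hη, ofLp_act, Matrix.mulVec_mulVec, Matrix.mul_nonsing_inv _ hdet,
        Matrix.one_mulVec]
      ring
    rw [hq, inner_add_left, inner_add_right]
    ring

/-- The log-density is the affine function `⟨η, x - a⟩ - ηᵀSη / 2` with `η = S⁻¹ h`; its mean under
the shifted Gaussian is `hᵀS⁻¹h / 2`. -/
theorem klDiv_multivariateGaussian (hS : S.PosDef) (a h : Euc n) :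
    klDiv (multivariateGaussian (a + h) S) (multivariateGaussian a S) =
      ENNReal.ofReal (1 / 2 * qf S⁻¹ h.ofLp) := by
  set η := act S⁻¹ h with hη
  have hps := hS.posSemidef
  have hdet := (Matrix.isUnit_iff_isUnit_det _).1 hS.isUnit
  have hac : multivariateGaussian (a + h) S ≪ multivariateGaussian a S := by
    rw [← multivariateGaussian_tilted hS]; exact tilted_absolutelyContinuous _ _
  have hllr : llr (multivariateGaussian (a + h) S) (multivariateGaussian a S)
      =ᵐ[multivariateGaussian (a + h) S]
      fun x => inner ℝ η x - (inner ℝ η a + qf S η.ofLp / 2) := by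
    refine hac.ae_le ?_
    have := log_rnDeriv_tilted_left_self (integrable_exp_inner hps a η)
    rw [multivariateGaussian_tilted hS, integral_exp_inner hps, Real.log_exp] at this
    exact this
  have hint : Integrable (fun x => inner ℝ η x - (inner ℝ η a + qf S η.ofLp / 2))
      (multivariateGaussian (a + h) S) := (integrable_inner _ _).sub (integrable_const _)
  rw [klDiv_of_ac_of_integrable hac (hint.congr hllr.symm), integral_congr_ae hllr,
    integral_sub (integrable_inner _ _) (integrable_const _), integral_inner]
  congr 1
  have h1 : inner ℝ η h = qf S⁻¹ h.ofLp := by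
    rw [hη, real_inner_comm, inner_act_self]
  have h2 : qf S η.ofLp = qf S⁻¹ h.ofLp := by
    rw [qf, hη, ofLp_act, Matrix.mulVec_mulVec, Matrix.mul_nonsing_inv _ hdet, Matrix.one_mulVec,
      dotProduct_comm, qf]
  simp only [integral_const, probReal_univ, inner_add_right, h1, h2]
  simp
  ring

end Gaussian

/-! ### Trigonometric moments of Gaussian measures -/

section Trigonometric

variable {n : ℕ} {S : Matrix (Fin n) (Fin n) ℝ}

/-- Sines and cosines of `⟨ξ, x⟩` are bounded with bounded gradient, so they are admissible in
`IsDualGeodesic`, whereas polynomials are not. -/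
lemma integral_cos_inner (hS : S.PosSemidef) (a ξ : Euc n) :
    ∫ x, Real.cos (inner ℝ ξ x) ∂(multivariateGaussian a S) =
      Real.exp (-(qf S ξ.ofLp / 2)) * Real.cos (inner ℝ ξ a) := by
  have h := congrArg Complex.re (charFun_multivariateGaussian (μ := a) hS ξ)
  rw [charFun_apply, ← RCLike.re_eq_complex_re, ← integral_re] at h
  · simp only [RCLike.re_eq_complex_re, Complex.exp_re] at h
    simpa [real_inner_comm, qf, Complex.ofReal_re, Complex.div_re] using h
  · refine (integrable_const (1 : ℝ)).mono' (by fun_prop) (Eventually.of_forall fun x => ?_)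
    simp [Complex.norm_exp]

lemma integral_sin_inner (hS : S.PosSemidef) (a ξ : Euc n) :
    ∫ x, Real.sin (inner ℝ ξ x) ∂(multivariateGaussian a S) =
      Real.exp (-(qf S ξ.ofLp / 2)) * Real.sin (inner ℝ ξ a) := by
  have h := congrArg Complex.im (charFun_multivariateGaussian (μ := a) hS ξ)
  rw [charFun_apply, ← RCLike.im_eq_complex_im, ← integral_im] at h
  · simp only [RCLike.im_eq_complex_im, Complex.exp_im] at h
    simpa [real_inner_comm, qf, Complex.ofReal_re, Complex.div_re] using h
  · refine (integrable_const (1 : ℝ)).mono' (by fun_prop) (Eventually.of_forall fun x => ?_)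
    simp [Complex.norm_exp]

lemma hasDerivAt_qf_line (hS : S.IsSymm) (ξ η : Euc n) :
    HasDerivAt (fun s : ℝ => qf S (ξ + s • η).ofLp) (2 * (η.ofLp ⬝ᵥ S *ᵥ ξ.ofLp)) 0 := by
  have e : (fun s : ℝ => qf S (ξ + s • η).ofLp) = fun s =>
      qf S ξ.ofLp + s * (2 * (η.ofLp ⬝ᵥ S *ᵥ ξ.ofLp)) + s ^ 2 * qf S η.ofLp := by
    ext s
    have : ξ.ofLp ⬝ᵥ S *ᵥ η.ofLp = η.ofLp ⬝ᵥ S *ᵥ ξ.ofLp := by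
      rw [Matrix.dotProduct_mulVec, ← Matrix.mulVec_transpose, hS, dotProduct_comm]
    rw [WithLp.ofLp_add, WithLp.ofLp_smul, qf_add_right hS, qf_smul_right, Matrix.mulVec_smul,
      dotProduct_smul, this, smul_eq_mul]
    ring
  rw [e]
  have h1 := ((hasDerivAt_id (0 : ℝ)).mul_const (2 * (η.ofLp ⬝ᵥ S *ᵥ ξ.ofLp))).const_add
    (qf S ξ.ofLp)
  have h2 := ((hasDerivAt_id (0 : ℝ)).fun_pow 2).mul_const (qf S η.ofLp)
  simpa using h1.fun_add h2

lemma integrable_inner_mul {f : Euc n → ℝ} (hf : Continuous f) (hf1 : ∀ x, |f x| ≤ 1)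
    (a η : Euc n) : Integrable (fun x => inner ℝ η x * f x) (multivariateGaussian a S) := by
  refine (integrable_inner a η).mul_bdd (c := 1) (by fun_prop) (Eventually.of_forall fun x => ?_)
  simpa using hf1 x

lemma hasDerivAt_integral_comp_inner {f f' : ℝ → ℝ} (hf : ∀ y, HasDerivAt f (f' y) y)
    (hf' : Continuous f') (hf1 : ∀ y, |f y| ≤ 1) (hf1' : ∀ y, |f' y| ≤ 1) (a ξ η : Euc n) :
    HasDerivAt (fun s : ℝ => ∫ x, f (inner ℝ (ξ + s • η) x) ∂(multivariateGaussian a S))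
      (∫ x, inner ℝ η x * f' (inner ℝ ξ x) ∂(multivariateGaussian a S)) 0 := by
  have hfc : Continuous f := continuous_iff_continuousAt.2 fun y => (hf y).continuousAt
  have h := hasDerivAt_integral_of_dominated_loc_of_deriv_le (μ := multivariateGaussian a S)
    (F := fun (s : ℝ) x => f (inner ℝ (ξ + s • η) x))
    (F' := fun (s : ℝ) x => inner ℝ η x * f' (inner ℝ (ξ + s • η) x))
    (x₀ := 0) (s := Set.univ) (bound := fun x => |inner ℝ η x|) univ_mem
    (Eventually.of_forall fun s => by fun_prop) ?_ (by fun_prop) ?_ ?_ ?_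
  · simpa using h.2
  · exact (integrable_const (1 : ℝ)).mono' (by fun_prop)
      (Eventually.of_forall fun x => by simpa using hf1 _)
  · refine Eventually.of_forall fun x s _ => ?_
    rw [Real.norm_eq_abs, abs_mul]
    exact mul_le_of_le_one_right (abs_nonneg _) (hf1' _)
  · exact (integrable_inner a η).abs
  · refine Eventually.of_forall fun x s _ => ?_
    have h1 : HasDerivAt (fun s : ℝ => inner ℝ (ξ + s • η) x) (inner ℝ η x) s := by
      simp only [inner_add_left, inner_smul_left, RCLike.conj_to_real]
      simpa using ((hasDerivAt_id s).mul_const (inner ℝ η x)).const_add (inner ℝ ξ x)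
    simpa [mul_comm, Function.comp_def] using (hf _).comp s h1

lemma hasDerivAt_inner_line (a ξ η : Euc n) :
    HasDerivAt (fun s : ℝ => inner ℝ (ξ + s • η) a) (inner ℝ η a) 0 := by
  simp only [inner_add_left, inner_smul_left, RCLike.conj_to_real]
  simpa using ((hasDerivAt_id (0 : ℝ)).mul_const (inner ℝ η a)).const_add (inner ℝ ξ a)

/-- Differentiate the cosine moment at frequency `ξ + s η` in `s`, once under the integral and once
in closed form. Such moments arise from the linear velocity field of a quadratic potential. -/
lemma integral_inner_mul_sin (hS : S.PosSemidef) (a ξ η : Euc n) :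
    ∫ x, inner ℝ η x * Real.sin (inner ℝ ξ x) ∂(multivariateGaussian a S) =
      Real.exp (-(qf S ξ.ofLp / 2)) * (inner ℝ η a * Real.sin (inner ℝ ξ a) +
        (η.ofLp ⬝ᵥ S *ᵥ ξ.ofLp) * Real.cos (inner ℝ ξ a)) := by
  have h1 := hasDerivAt_integral_comp_inner (S := S) (f := Real.cos) (f' := fun y => -Real.sin y)
    Real.hasDerivAt_cos (by fun_prop) Real.abs_cos_le_one
    (fun y => by simpa using Real.abs_sin_le_one y) a ξ η
  simp only [integral_cos_inner hS] at h1
  have h2 := (((hasDerivAt_qf_line (isSymm_of_posSemidef hS) ξ η).div_const 2).neg.exp).mul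
    (hasDerivAt_inner_line a ξ η).cos
  have h3 := h1.unique h2
  simp only [mul_neg, integral_neg, zero_smul, add_zero] at h3
  simp only [Pi.neg_apply, zero_smul, add_zero] at h3
  linear_combination -h3

lemma integral_inner_mul_cos (hS : S.PosSemidef) (a ξ η : Euc n) :
    ∫ x, inner ℝ η x * Real.cos (inner ℝ ξ x) ∂(multivariateGaussian a S) =
      Real.exp (-(qf S ξ.ofLp / 2)) * (inner ℝ η a * Real.cos (inner ℝ ξ a) -
        (η.ofLp ⬝ᵥ S *ᵥ ξ.ofLp) * Real.sin (inner ℝ ξ a)) := by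
  have h1 := hasDerivAt_integral_comp_inner (S := S) (f := Real.sin) (f' := Real.cos)
    Real.hasDerivAt_sin (by fun_prop) Real.abs_sin_le_one Real.abs_cos_le_one a ξ η
  simp only [integral_sin_inner hS] at h1
  have h2 := (((hasDerivAt_qf_line (isSymm_of_posSemidef hS) ξ η).div_const 2).neg.exp).mul
    (hasDerivAt_inner_line a ξ η).sin
  have h3 := h1.unique h2
  simp only [zero_smul, add_zero, Pi.neg_apply] at h3
  linear_combination h3

end Trigonometric

/-! ### Dual geodesics in the Gaussian family -/

section Geodesic

variable {n : ℕ}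

lemma gradient_quadPotential {S : Matrix (Fin n) (Fin n) ℝ} (hS : S.IsSymm) (b x : Euc n) :
    gradient (quadPotential S b) x = act S x + b := by
  refine HasGradientAt.gradient ?_
  rw [hasGradientAt_iff_hasFDerivAt]
  set T : Euc n →L[ℝ] Euc n := (Matrix.toEuclideanLin S).toContinuousLinearMap with hT
  have hTx : ∀ y, T y = act S y := fun y => rfl
  have h1 : HasFDerivAt (fun y : Euc n => (inner ℝ y (T y) : ℝ)) _ x :=
    (hasFDerivAt_id x).inner ℝ T.hasFDerivAt
  have h2 : HasFDerivAt (fun y : Euc n => (inner ℝ b y : ℝ)) (innerSL ℝ b) x :=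
    (innerSL ℝ b).hasFDerivAt
  refine ((h1.const_mul (1 / 2)).add h2).congr_fderiv ?_
  ext y
  have hsym : inner ℝ x (act S y) = inner ℝ (act S x) y := by
    rw [inner_eq_dotProduct, inner_eq_dotProduct, ofLp_act, ofLp_act, Matrix.dotProduct_mulVec,
      ← Matrix.mulVec_transpose, hS]
  simp [hTx, hsym, real_inner_comm (act S x) y]
  ring

lemma covMatrix_multivariateGaussian {S : Matrix (Fin n) (Fin n) ℝ} (hS : S.PosSemidef)
    (a : Euc n) : covMatrix (multivariateGaussian a S) = S := by
  ext i j
  simp [covMatrix, covariance_eval_multivariateGaussian hS]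

lemma multivariateGaussian_inj {S S' : Matrix (Fin n) (Fin n) ℝ} (hS : S.PosSemidef)
    (hS' : S'.PosSemidef) {a a' : Euc n}
    (h : multivariateGaussian a S = multivariateGaussian a' S') : a = a' ∧ S = S' := by
  constructor
  · rw [← integral_id_multivariateGaussian (μ := a) (S := S), h, integral_id_multivariateGaussian]
  · rw [← covMatrix_multivariateGaussian hS a, h, covMatrix_multivariateGaussian hS']

lemma multivariateGaussian_add (S : Matrix (Fin n) (Fin n) ℝ) (a v : Euc n) :
    multivariateGaussian (a + v) S = (multivariateGaussian a S).map (fun x => x + v) := by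
  rw [multivariateGaussian, multivariateGaussian, Measure.map_map (by fun_prop) (by fun_prop)]
  congr 1
  ext1 x
  simp only [Function.comp_apply]
  abel

lemma gradient_comp_inner {f f' : ℝ → ℝ} (hf : ∀ y, HasDerivAt f (f' y) y) (ξ x : Euc n) :
    gradient (fun x : Euc n => f (inner ℝ ξ x)) x = f' (inner ℝ ξ x) • ξ := by
  refine HasGradientAt.gradient ?_
  rw [hasGradientAt_iff_hasFDerivAt]
  refine ((hf _).comp_hasFDerivAt x (innerSL ℝ ξ).hasFDerivAt).congr_fderiv ?_
  ext y
  simp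

/-- With `D = √σ`, the trace is the sum of `K` over the columns of `N D`, which do not all vanish
since `D` is invertible. This strictness rules out curved potentials and gives uniqueness of the
optimal gain. -/
lemma trace_conj_mul_pos {m : ℕ} {K : Matrix (Fin m) (Fin m) ℝ} {σ : Matrix (Fin n) (Fin n) ℝ}
    (hK : K.PosDef) (hσ : σ.PosDef) {N : Matrix (Fin m) (Fin n) ℝ} (h0 : N ≠ 0) :
    0 < (Nᵀ * K * N * σ).trace := by
  set D := CFC.sqrt σ with hD
  have hDs : D.IsSymm := isSymm_of_posSemidef (Matrix.nonneg_iff_posSemidef.1 (CFC.sqrt_nonneg σ))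
  have hDD : D * D = σ := CFC.sqrt_mul_sqrt_self _ hσ.posSemidef.nonneg
  have hu : IsUnit D.det := by
    have := (Matrix.isUnit_iff_isUnit_det _).1 hσ.isUnit
    rw [← hDD, Matrix.det_mul] at this
    exact isUnit_of_mul_isUnit_right this
  have e : (Nᵀ * K * N * σ).trace = ∑ i, qf K ((N * D) *ᵥ Pi.single i 1) := by
    have h2 : D * (Nᵀ * K * N * D) = (N * D)ᵀ * K * (N * D) := by
      rw [Matrix.transpose_mul, hDs]; simp only [Matrix.mul_assoc]
    rw [← hDD, ← Matrix.mul_assoc, Matrix.trace_mul_comm, h2, Matrix.trace]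
    refine Finset.sum_congr rfl fun i _ => ?_
    rw [← qf_conj, qf]
    simp
  rw [e]
  have hne : ∃ i, (N * D) *ᵥ Pi.single i 1 ≠ 0 := by
    by_contra! h
    refine h0 ?_
    have : N * D = 0 := by
      ext i j
      simpa using congrFun (h j) i
    calc N = N * D * D⁻¹ := by rw [Matrix.mul_assoc, Matrix.mul_nonsing_inv _ hu, Matrix.mul_one]
      _ = 0 := by rw [this, Matrix.zero_mul]
  obtain ⟨i, hi⟩ := hne
  exact Finset.sum_pos' (fun i _ => qf_nonneg hK.posSemidef _) ⟨i, Finset.mem_univ i, qf_pos hK hi⟩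

variable {C : Mobility n} {K : Matrix (Fin n) (Fin n) ℝ → Matrix (Fin n) (Fin n) ℝ}
  {c : ℝ → Measure (Euc n)} {S : Matrix (Fin n) (Fin n) ℝ} {b : Euc n} {a : ℝ → Euc n}
  {σ : ℝ → Matrix (Fin n) (Fin n) ℝ}

lemma inner_act_act_add {K S : Matrix (Fin n) (Fin n) ℝ} (hK : K.IsSymm) (hS : S.IsSymm)
    (ξ x b : Euc n) : inner ℝ ξ (act K (act S x + b)) =
      inner ℝ (act (S * K) ξ) x + inner ℝ ξ (act K b) := by
  simp only [inner_eq_dotProduct, ofLp_act, WithLp.ofLp_add, Matrix.mulVec_add, dotProduct_add,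
    Matrix.mulVec_mulVec]
  congr 1
  rw [Matrix.dotProduct_mulVec, ← Matrix.mulVec_transpose, Matrix.transpose_mul, hK, hS]

/-- The evolution of the trigonometric moments along a dual geodesic. -/
lemma hasDerivWithinAt_trig (hC : ∀ a S, S.PosDef → C (multivariateGaussian a S) = K S)
    (hK : ∀ S, S.PosDef → (K S).PosDef) (hS : S.IsSymm)
    (hc : ∀ t ∈ Set.Icc (0 : ℝ) 1, (σ t).PosDef ∧ c t = multivariateGaussian (a t) (σ t))
    (hg : IsDualGeodesic C (quadPotential S b) c) (ξ : Euc n) {t : ℝ}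
    (ht : t ∈ Set.Icc (0 : ℝ) 1) :
    HasDerivWithinAt
      (fun s => Real.exp (-(qf (σ s) ξ.ofLp / 2)) * Real.cos (inner ℝ ξ (a s)))
      (-(inner ℝ ξ (act (K (σ t)) (act S (a t) + b))) *
          (Real.exp (-(qf (σ t) ξ.ofLp / 2)) * Real.sin (inner ℝ ξ (a t))) -
        (((S * K (σ t)) *ᵥ ξ.ofLp) ⬝ᵥ σ t *ᵥ ξ.ofLp) *
          (Real.exp (-(qf (σ t) ξ.ofLp / 2)) * Real.cos (inner ℝ ξ (a t)))) (Set.Icc 0 1) t ∧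
    HasDerivWithinAt
      (fun s => Real.exp (-(qf (σ s) ξ.ofLp / 2)) * Real.sin (inner ℝ ξ (a s)))
      (inner ℝ ξ (act (K (σ t)) (act S (a t) + b)) *
          (Real.exp (-(qf (σ t) ξ.ofLp / 2)) * Real.cos (inner ℝ ξ (a t))) -
        (((S * K (σ t)) *ᵥ ξ.ofLp) ⬝ᵥ σ t *ᵥ ξ.ofLp) *
          (Real.exp (-(qf (σ t) ξ.ofLp / 2)) * Real.sin (inner ℝ ξ (a t)))) (Set.Icc 0 1) t := by
  obtain ⟨hσ, hct⟩ := hc t ht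
  have hKs := isSymm_of_posSemidef (hK _ hσ).posSemidef
  have hps := hσ.posSemidef
  have key : ∀ f f' : ℝ → ℝ, ContDiff ℝ (⊤ : ℕ∞) f → (∀ y, HasDerivAt f (f' y) y) →
      (∀ y, |f y| ≤ 1) → (∀ y, |f' y| ≤ 1) →
      HasDerivWithinAt (fun s => ∫ x, f (inner ℝ ξ x) ∂(c s))
        (∫ x, f' (inner ℝ ξ x) * (inner ℝ (act (S * K (σ t)) ξ) x +
          inner ℝ ξ (act (K (σ t)) b)) ∂(multivariateGaussian (a t) (σ t))) (Set.Icc 0 1) t := by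
    intro f f' hf hff' hf1 hf1'
    have h := hg (fun x => f (inner ℝ ξ x))
      (hf.comp (contDiff_const.inner ℝ contDiff_id)) ⟨max 1 ‖ξ‖, fun x =>
      ⟨(hf1 _).trans (le_max_left _ _), ?_⟩⟩ t ht
    · convert! h using 1
      rw [hct]
      refine integral_congr_ae (Eventually.of_forall fun x => ?_)
      simp only [velocity]
      rw [gradient_comp_inner hff', gradient_quadPotential hS, hC _ _ hσ, inner_smul_left,
        inner_act_act_add hKs hS]
      simp
    · rw [gradient_comp_inner hff', norm_smul]
      exact (mul_le_of_le_one_left (norm_nonneg _) (hf1' _)).trans (le_max_right _ _)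
  have hm : inner ℝ ξ (act (K (σ t)) (act S (a t) + b)) =
      inner ℝ (act (S * K (σ t)) ξ) (a t) + inner ℝ ξ (act (K (σ t)) b) :=
    inner_act_act_add hKs hS _ _ _
  have hcos : Integrable (fun x : Euc n => Real.cos (inner ℝ ξ x))
      (multivariateGaussian (a t) (σ t)) := (integrable_const (1 : ℝ)).mono' (by fun_prop)
    (Eventually.of_forall fun x => by simpa using Real.abs_cos_le_one _)
  have hsin : Integrable (fun x : Euc n => Real.sin (inner ℝ ξ x))
      (multivariateGaussian (a t) (σ t)) := (integrable_const (1 : ℝ)).mono' (by fun_prop)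
    (Eventually.of_forall fun x => by simpa using Real.abs_sin_le_one _)
  constructor
  · have h := key Real.cos (fun y => -Real.sin y) Real.contDiff_cos Real.hasDerivAt_cos
      Real.abs_cos_le_one (fun y => by simpa using Real.abs_sin_le_one y)
    refine (h.congr_of_mem (fun s hs => ?_) ht).congr_deriv ?_
    · rw [(hc s hs).2, integral_cos_inner (hc s hs).1.posSemidef]
    · have e : ∀ x : Euc n, -Real.sin (inner ℝ ξ x) * (inner ℝ (act (S * K (σ t)) ξ) x +
          inner ℝ ξ (act (K (σ t)) b)) = -(inner ℝ (act (S * K (σ t)) ξ) x *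
            Real.sin (inner ℝ ξ x) + inner ℝ ξ (act (K (σ t)) b) * Real.sin (inner ℝ ξ x)) :=
        fun x => by ring
      simp only [e]
      rw [integral_neg, integral_add (integrable_inner_mul (by fun_prop)
        (fun x => Real.abs_sin_le_one _) _ _) (hsin.const_mul _), integral_const_mul,
        integral_sin_inner hps, integral_inner_mul_sin hps, hm, ofLp_act]
      ring
  · have h := key Real.sin Real.cos Real.contDiff_sin Real.hasDerivAt_sin
      Real.abs_sin_le_one Real.abs_cos_le_one
    refine (h.congr_of_mem (fun s hs => ?_) ht).congr_deriv ?_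
    · rw [(hc s hs).2, integral_sin_inner (hc s hs).1.posSemidef]
    · have e : ∀ x : Euc n, Real.cos (inner ℝ ξ x) * (inner ℝ (act (S * K (σ t)) ξ) x +
          inner ℝ ξ (act (K (σ t)) b)) = inner ℝ (act (S * K (σ t)) ξ) x *
            Real.cos (inner ℝ ξ x) + inner ℝ ξ (act (K (σ t)) b) * Real.cos (inner ℝ ξ x) :=
        fun x => by ring
      simp only [e]
      rw [integral_add (integrable_inner_mul (by fun_prop)
        (fun x => Real.abs_cos_le_one _) _ _) (hcos.const_mul _), integral_const_mul,
        integral_cos_inner hps, integral_inner_mul_cos hps, hm, ofLp_act]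
      ring

/-- The evolution of the covariance along a dual geodesic. -/
lemma hasDerivWithinAt_qf_cov (hC : ∀ a S, S.PosDef → C (multivariateGaussian a S) = K S)
    (hK : ∀ S, S.PosDef → (K S).PosDef) (hS : S.IsSymm)
    (hc : ∀ t ∈ Set.Icc (0 : ℝ) 1, (σ t).PosDef ∧ c t = multivariateGaussian (a t) (σ t))
    (hg : IsDualGeodesic C (quadPotential S b) c) (v : Fin n → ℝ) {t : ℝ}
    (ht : t ∈ Set.Icc (0 : ℝ) 1) :
    HasDerivWithinAt (fun s => qf (σ s) v) (2 * qf (K (σ t) * S * σ t) v) (Set.Icc 0 1) t := by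
  set ξ : Euc n := WithLp.toLp 2 v with hξ
  obtain ⟨h1, h2⟩ := hasDerivWithinAt_trig hC hK hS hc hg ξ ht
  have h3 := ((h1.fun_pow 2).add (h2.fun_pow 2))
  -- Adding the squares of the two moments removes the mean; a logarithm then isolates the
  -- covariance.
  have hpos : ∀ s, (Real.exp (-(qf (σ s) ξ.ofLp / 2)) * Real.cos (inner ℝ ξ (a s))) ^ 2 +
      (Real.exp (-(qf (σ s) ξ.ofLp / 2)) * Real.sin (inner ℝ ξ (a s))) ^ 2 =
        Real.exp (-qf (σ s) v) := fun s => by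
    rw [mul_pow, mul_pow, ← mul_add, Real.cos_sq_add_sin_sq, mul_one, ← Real.exp_nat_mul]
    congr 1
    push_cast
    rw [hξ]
    ring
  have h4 := (h3.log (by simp only [Pi.add_apply]; rw [hpos]; positivity)).neg
  have e : ((fun s => Real.log (((fun s => (Real.exp (-(qf (σ s) ξ.ofLp / 2)) *
      Real.cos (inner ℝ ξ (a s))) ^ 2) + fun s => (Real.exp (-(qf (σ s) ξ.ofLp / 2)) *
      Real.sin (inner ℝ ξ (a s))) ^ 2) s))) = fun s => -qf (σ s) v := by
    ext s
    simp only [Pi.add_apply, hpos, Real.log_exp]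
  have hsym := isSymm_of_posSemidef (hK _ (hc t ht).1).posSemidef
  have hr : ((S * K (σ t)) *ᵥ ξ.ofLp) ⬝ᵥ σ t *ᵥ ξ.ofLp = qf (K (σ t) * S * σ t) v := by
    rw [qf, ← Matrix.mulVec_mulVec v (K (σ t) * S), Matrix.dotProduct_mulVec v (K (σ t) * S),
      ← Matrix.mulVec_transpose, Matrix.transpose_mul, hS, hsym]
  rw [e] at h4
  refine (h4.congr_of_mem (fun s _ => by simp) ht).congr_deriv ?_
  simp only [Pi.add_apply]
  rw [hpos, hr, ← neg_div, div_eq_iff (Real.exp_pos _).ne', ← hpos t]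
  push_cast
  ring

end Geodesic

/-! ### Rigidity of geodesics with equal end covariances, and the closed form of the divergences. -/

section Divergence

variable {n : ℕ} {C : Mobility n} {K : Matrix (Fin n) (Fin n) ℝ → Matrix (Fin n) (Fin n) ℝ}
  {c : ℝ → Measure (Euc n)} {S : Matrix (Fin n) (Fin n) ℝ} {b : Euc n} {a : ℝ → Euc n}
  {σ : ℝ → Matrix (Fin n) (Fin n) ℝ}

/-- The covariance of a dual geodesic can only return to its initial value if the potential is
affine. -/
lemma potential_eq_zero (hC : ∀ a S, S.PosDef → C (multivariateGaussian a S) = K S)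
    (hK : ∀ S, S.PosDef → (K S).PosDef) (hS : S.IsSymm)
    (hc : ∀ t ∈ Set.Icc (0 : ℝ) 1, (σ t).PosDef ∧ c t = multivariateGaussian (a t) (σ t))
    (hg : IsDualGeodesic C (quadPotential S b) c) (h01 : σ 0 = σ 1) : S = 0 := by
  by_contra h0
  -- `T = tr (S σ)` has derivative `2 tr (S K S σ)`, positive for `S ≠ 0`, yet `σ 0 = σ 1` makes its
  -- end values equal.
  set T : ℝ → ℝ := fun t => ∑ i, ∑ j, S i j * σ t i j with hT
  have hderiv : ∀ t ∈ Set.Icc (0 : ℝ) 1,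
      HasDerivWithinAt T (2 * (S * (K (σ t) * S * σ t)).trace) (Set.Icc 0 1) t := by
    intro t ht
    set W := K (σ t) * S * σ t with hW
    have hij : ∀ i j, HasDerivWithinAt (fun s => σ s i j) (W i j + W j i) (Set.Icc 0 1) t := by
      intro i j
      have hq := fun v => hasDerivWithinAt_qf_cov hC hK hS hc hg v ht
      have h := (((hq (Pi.single i 1 + Pi.single j 1)).sub (hq (Pi.single i 1))).sub
        (hq (Pi.single j 1))).div_const 2
      refine (h.congr_of_mem (fun s hs => ?_) ht).congr_deriv ?_
      · rw [apply_eq_qf (isSymm_of_posSemidef (hc s hs).1.posSemidef)]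
        rfl
      · rw [← hW]
        simp only [qf, Matrix.mulVec_add, dotProduct_add, add_dotProduct]
        simp
        ring
    have h := HasDerivWithinAt.fun_sum (u := Finset.univ) fun i (_ : i ∈ Finset.univ) =>
      HasDerivWithinAt.fun_sum (u := Finset.univ) fun j (_ : j ∈ Finset.univ) =>
        (hij i j).const_mul (S i j)
    refine h.congr_deriv ?_
    have e1 : ∑ i, ∑ j, S i j * W j i = (S * W).trace := by
      simp [Matrix.trace, Matrix.mul_apply]
    have e2 : ∑ i, ∑ j, S i j * W i j = (S * W).trace := by
      rw [← e1, Finset.sum_comm]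
      exact Finset.sum_congr rfl fun i _ => Finset.sum_congr rfl fun j _ => by rw [hS.apply i j]
    simp only [mul_add, Finset.sum_add_distrib]
    rw [e1, e2]
    ring
  have hmono : StrictMonoOn T (Set.Icc 0 1) := by
    refine strictMonoOn_of_deriv_pos (convex_Icc 0 1)
      (fun t ht => (hderiv t ht).continuousWithinAt) fun t ht => ?_
    rw [interior_Icc] at ht
    have ht' := Set.Ioo_subset_Icc_self ht
    rw [((hderiv t ht').hasDerivAt (Icc_mem_nhds ht.1 ht.2)).deriv]
    have hσ := (hc t ht').1
    have := trace_conj_mul_pos (hK _ hσ) hσ h0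
    rw [hS, Matrix.mul_assoc S, Matrix.mul_assoc S] at this
    linarith
  have := hmono (Set.left_mem_Icc.2 zero_le_one) (Set.right_mem_Icc.2 zero_le_one) one_pos
  rw [hT] at this
  simp only [h01] at this
  exact lt_irrefl _ this

lemma eq_of_hasDerivWithinAt_zero {f : ℝ → ℝ}
    (h : ∀ t ∈ Set.Icc (0 : ℝ) 1, HasDerivWithinAt f 0 (Set.Icc 0 1) t) :
    ∀ t ∈ Set.Icc (0 : ℝ) 1, f t = f 0 :=
  constant_of_derivWithin_zero (fun t ht => (h t ht).differentiableWithinAt) fun t ht =>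
    (h t (Set.Ico_subset_Icc_self ht)).derivWithin
      (uniqueDiffOn_Icc_zero_one t (Set.Ico_subset_Icc_self ht))

lemma covariance_eq_of_affine (hC : ∀ a S, S.PosDef → C (multivariateGaussian a S) = K S)
    (hK : ∀ S, S.PosDef → (K S).PosDef)
    (hc : ∀ t ∈ Set.Icc (0 : ℝ) 1, (σ t).PosDef ∧ c t = multivariateGaussian (a t) (σ t))
    (hg : IsDualGeodesic C (quadPotential 0 b) c) {t : ℝ} (ht : t ∈ Set.Icc (0 : ℝ) 1) :
    σ t = σ 0 := by
  have h0 := Set.left_mem_Icc.2 (zero_le_one (α := ℝ))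
  refine eq_of_qf_eq (isSymm_of_posSemidef (hc t ht).1.posSemidef)
    (isSymm_of_posSemidef (hc 0 h0).1.posSemidef) fun v => ?_
  refine eq_of_hasDerivWithinAt_zero (f := fun s => qf (σ s) v) (fun s hs => ?_) t ht
  have := hasDerivWithinAt_qf_cov hC hK Matrix.isSymm_zero hc hg v hs
  simpa [qf] using this

/-- The mean `a` is not known to be continuous; only `cos ⟨ξ, a⟩` and `sin ⟨ξ, a⟩` are seen to be
differentiable. They rotate at the constant rate `β`, which determines `⟨ξ, d⟩` modulo `2π` for
every `ξ`, hence `d = 0`. -/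
lemma mean_sub_eq_of_affine (hC : ∀ a S, S.PosDef → C (multivariateGaussian a S) = K S)
    (hK : ∀ S, S.PosDef → (K S).PosDef)
    (hc : ∀ t ∈ Set.Icc (0 : ℝ) 1, (σ t).PosDef ∧ c t = multivariateGaussian (a t) (σ t))
    (hg : IsDualGeodesic C (quadPotential 0 b) c) :
    a 1 - a 0 = act (K (σ 0)) b := by
  have hσ : ∀ t ∈ Set.Icc (0 : ℝ) 1, σ t = σ 0 := fun t ht =>
    covariance_eq_of_affine hC hK hc hg ht
  set d := a 1 - a 0 - act (K (σ 0)) b with hd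
  suffices h : ∀ ξ : Euc n, Real.cos (inner ℝ ξ d) = 1 by
    by_contra h0
    have hd0 : d ≠ 0 := fun h1 => h0 (by rwa [hd, sub_eq_zero] at h1)
    -- For this `ξ` the inner product with `d` is exactly `π`, whose cosine is `-1`.
    have h1 := h ((Real.pi / ‖d‖ ^ 2) • d)
    have h2 : ‖d‖ ^ 2 ≠ 0 := by simpa using hd0
    rw [inner_smul_left, real_inner_self_eq_norm_sq, RCLike.conj_to_real, div_mul_cancel₀ _ h2,
      Real.cos_pi] at h1
    norm_num at h1
  intro ξ
  set β := inner ℝ ξ (act (K (σ 0)) b) with hβ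
  set E := Real.exp (-(qf (σ 0) ξ.ofLp / 2)) with hE
  have hE0 : E ≠ 0 := (Real.exp_pos _).ne'
  have h := fun t ht => hasDerivWithinAt_trig hC hK Matrix.isSymm_zero hc hg ξ (t := t) ht
  have hcos : ∀ t ∈ Set.Icc (0 : ℝ) 1, HasDerivWithinAt
      (fun s => E * Real.cos (inner ℝ ξ (a s))) (-β * (E * Real.sin (inner ℝ ξ (a t))))
      (Set.Icc 0 1) t := fun t ht => by
    refine ((h t ht).1.congr_of_mem (fun s hs => ?_) ht).congr_deriv ?_
    · rw [hσ s hs]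
    · rw [hσ t ht]; simp [act_eq, hβ, hE]
  have hsin : ∀ t ∈ Set.Icc (0 : ℝ) 1, HasDerivWithinAt
      (fun s => E * Real.sin (inner ℝ ξ (a s))) (β * (E * Real.cos (inner ℝ ξ (a t))))
      (Set.Icc 0 1) t := fun t ht => by
    refine ((h t ht).2.congr_of_mem (fun s hs => ?_) ht).congr_deriv ?_
    · rw [hσ s hs]
    · rw [hσ t ht]; simp [act_eq, hβ, hE]
  have hlin : ∀ t, HasDerivWithinAt (fun s : ℝ => s * β) β (Set.Icc 0 1) t := fun t => by
    simpa using ((hasDerivAt_id t).mul_const β).hasDerivWithinAt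
  have h1 : (0 : ℝ) ≤ 1 := zero_le_one
  -- `c1` and `c2` express that `E cos (⟨ξ, a s⟩ - s β)` and `E sin (⟨ξ, a s⟩ - s β)` are conserved.
  have c1 := eq_of_hasDerivWithinAt_zero
    (f := fun s => E * Real.cos (inner ℝ ξ (a s)) * Real.cos (s * β) +
      E * Real.sin (inner ℝ ξ (a s)) * Real.sin (s * β)) (fun t ht => by
      refine (((hcos t ht).fun_mul (hlin t).cos).fun_add
        ((hsin t ht).fun_mul (hlin t).sin)).congr_deriv ?_
      ring) 1 (Set.right_mem_Icc.2 h1)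
  have c2 := eq_of_hasDerivWithinAt_zero
    (f := fun s => E * Real.sin (inner ℝ ξ (a s)) * Real.cos (s * β) -
      E * Real.cos (inner ℝ ξ (a s)) * Real.sin (s * β)) (fun t ht => by
      refine (((hsin t ht).fun_mul (hlin t).cos).fun_sub
        ((hcos t ht).fun_mul (hlin t).sin)).congr_deriv ?_
      ring) 1 (Set.right_mem_Icc.2 h1)
  simp only [one_mul, zero_mul, Real.cos_zero, Real.sin_zero, mul_one, mul_zero, add_zero,
    sub_zero, mul_assoc, ← mul_add, ← mul_sub] at c1 c2
  replace c1 := mul_left_cancel₀ hE0 c1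
  replace c2 := mul_left_cancel₀ hE0 c2
  rw [← Real.cos_sub] at c1
  rw [← Real.sin_sub] at c2
  have e : inner ℝ ξ d = inner ℝ ξ (a 1) - β - inner ℝ ξ (a 0) := by
    rw [hd, inner_sub_right, inner_sub_right]; ring
  rw [e, Real.cos_sub, c1, c2, ← sq, ← sq, Real.cos_sq_add_sin_sq]

lemma weightedEnergy_of_affine (hC : ∀ a S, S.PosDef → C (multivariateGaussian a S) = K S)
    {Sw : Matrix (Fin n) (Fin n) ℝ} (hSw : Sw.PosDef) (hK : (K Sw).PosDef)
    (hc : ∀ t ∈ Set.Icc (0 : ℝ) 1, c t = multivariateGaussian (a t) Sw) :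
    weightedEnergy C (quadPotential 0 b) c = ENNReal.ofReal (1 / 2 * qf (K Sw) b.ofLp) := by
  have h1 : ∀ t ∈ Set.Icc (0 : ℝ) 1, ENNReal.ofReal (t * ∫ x, inner ℝ
      (gradient (quadPotential 0 b) x) (velocity C (quadPotential 0 b) (c t) x) ∂(c t)) =
      ENNReal.ofReal (t * qf (K Sw) b.ofLp) := fun t ht => by
    have hz : ∀ x : Euc n, act (0 : Matrix (Fin n) (Fin n) ℝ) x = 0 := fun x => by simp [act_eq]
    simp only [velocity, gradient_quadPotential Matrix.isSymm_zero, hz, zero_add]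
    rw [hc t ht, hC _ _ hSw, inner_act_self]
    simp
  rw [weightedEnergy, setLIntegral_congr_fun measurableSet_Icc h1,
    ← ofReal_integral_eq_lintegral_ofReal]
  · congr 1
    rw [integral_Icc_eq_integral_Ioc, ← intervalIntegral.integral_of_le zero_le_one,
      intervalIntegral.integral_mul_const, integral_id]
    norm_num
  · exact (Continuous.integrableOn_Icc (by fun_prop))
  · filter_upwards [ae_restrict_mem measurableSet_Icc] with t ht
    exact mul_nonneg ht.1 (qf_nonneg hK.posSemidef _)

/-- The translations of a Gaussian measure are a dual geodesic with affine potential. -/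
lemma isDualGeodesic_translation (hC : ∀ a S, S.PosDef → C (multivariateGaussian a S) = K S)
    {Sw : Matrix (Fin n) (Fin n) ℝ} (hSw : Sw.PosDef) (a₀ b : Euc n) :
    IsDualGeodesic C (quadPotential 0 b)
      (fun t => multivariateGaussian (a₀ + t • act (K Sw) b) Sw) := by
  intro φ hφ ⟨k, hk⟩ t _
  set h := act (K Sw) b with hh
  have hφc : Continuous φ := hφ.continuous
  have hgc : Continuous (gradient φ) := by
    have := hφ.continuous_fderiv (by simp)
    unfold gradient
    fun_prop
  have hz : ∀ x : Euc n, act (0 : Matrix (Fin n) (Fin n) ℝ) x = 0 := fun x => by simp [act_eq]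
  have e : ∀ f : Euc n → ℝ, Continuous f → ∀ s : ℝ,
      ∫ x, f x ∂(multivariateGaussian (a₀ + s • h) Sw) =
        ∫ x, f (x + s • h) ∂(multivariateGaussian a₀ Sw) := fun f hf s => by
    rw [multivariateGaussian_add, integral_map (by fun_prop) (by fun_prop)]
  simp only [velocity, gradient_quadPotential Matrix.isSymm_zero, hz, zero_add,
    hC _ _ hSw, ← hh]
  rw [e _ (by fun_prop)]
  simp only [e φ hφc]
  have hd := hasDerivAt_integral_of_dominated_loc_of_deriv_le
    (μ := multivariateGaussian a₀ Sw) (F := fun (s : ℝ) x => φ (x + s • h))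
    (F' := fun (s : ℝ) x => inner ℝ (gradient φ (x + s • h)) h)
    (x₀ := t) (s := Set.univ) (bound := fun _ => k * ‖h‖) univ_mem
    (Eventually.of_forall fun s => by fun_prop) ?_ (by fun_prop) ?_ (integrable_const _) ?_
  · exact hd.2.hasDerivWithinAt
  · exact (integrable_const k).mono' (by fun_prop) (Eventually.of_forall fun x => (hk _).1)
  · refine Eventually.of_forall fun x s _ => (norm_inner_le_norm _ _).trans ?_
    gcongr
    exact (hk _).2
  · refine Eventually.of_forall fun x s _ => ?_
    have h1 : HasDerivAt (fun s : ℝ => x + s • h) h s := by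
      simpa using ((hasDerivAt_id s).smul_const h).const_add x
    have h2 := ((hφ.differentiable (by simp)) (x + s • h)).hasFDerivAt.comp_hasDerivAt s h1
    rwa [← inner_gradient_left] at h2

/-- The translation with potential `⟨b, x⟩` is a competitor. Conversely, every competitor has `S =
0`, constant covariance and `K b = -h`, the sign because the curve runs from `a + h` back to `a`.
Its energy is `bᵀKb ∫₀¹ t dt = hᵀK⁻¹h / 2`. -/
theorem gaussianDivergence_eq (hC : ∀ a S, S.PosDef → C (multivariateGaussian a S) = K S)
    (hK : ∀ S, S.PosDef → (K S).PosDef) {Sw : Matrix (Fin n) (Fin n) ℝ} (hSw : Sw.PosDef)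
    (a h : Euc n) :
    gaussianDivergence C (multivariateGaussian (a + h) Sw) (multivariateGaussian a Sw) =
      ENNReal.ofReal (1 / 2 * qf (K Sw)⁻¹ h.ofLp) := by
  have hdet := (Matrix.isUnit_iff_isUnit_det _).1 (hK _ hSw).isUnit
  have hq : ∀ b : Euc n, act (K Sw) b = -h → qf (K Sw) b.ofLp = qf (K Sw)⁻¹ h.ofLp := by
    intro b hb
    have hb' : h.ofLp = (-K Sw) *ᵥ b.ofLp := by
      have := congrArg WithLp.ofLp hb
      rw [ofLp_act, WithLp.ofLp_neg] at this
      rw [Matrix.neg_mulVec, this, neg_neg]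
    have hs := isSymm_of_posSemidef (hK _ hSw).posSemidef
    rw [hb', ← qf_conj]
    simp only [Matrix.transpose_neg, hs.eq, neg_mul, Matrix.mul_neg, neg_neg,
      Matrix.mul_nonsing_inv _ hdet, Matrix.one_mul]
  refine le_antisymm ?_ ?_
  · set b : Euc n := act (K Sw)⁻¹ (-h) with hb
    have hKb : act (K Sw) b = -h := by
      rw [hb, act_eq, ofLp_act, Matrix.mulVec_mulVec, Matrix.mul_nonsing_inv _ hdet,
        Matrix.one_mulVec]
    refine iInf_le_of_le (fun t => multivariateGaussian ((a + h) + t • act (K Sw) b) Sw)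
      (iInf_le_of_le 0 (iInf_le_of_le b (iInf_le_of_le ⟨Matrix.isSymm_zero,
        fun t _ => ⟨_, Sw, hSw, rfl⟩, isDualGeodesic_translation hC hSw _ _, by simp, ?_⟩ ?_)))
    · simp [hKb]
    · rw [weightedEnergy_of_affine hC hSw (hK _ hSw) fun t _ => rfl, hq b hKb]
  · refine le_iInf fun c => le_iInf fun S => le_iInf fun b => le_iInf fun ⟨hS, hcur, hg, hc0, hc1⟩ =>
      ?_
    choose! m σ hc using hcur
    have i0 := Set.left_mem_Icc.2 (zero_le_one (α := ℝ))
    have i1 := Set.right_mem_Icc.2 (zero_le_one (α := ℝ))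
    obtain ⟨m0, s0⟩ := multivariateGaussian_inj (hc 0 i0).1.posSemidef hSw.posSemidef
      ((hc 0 i0).2.symm.trans hc0)
    obtain ⟨m1, s1⟩ := multivariateGaussian_inj (hc 1 i1).1.posSemidef hSw.posSemidef
      ((hc 1 i1).2.symm.trans hc1)
    obtain rfl := potential_eq_zero hC hK hS hc hg (s0.trans s1.symm)
    have hm := mean_sub_eq_of_affine hC hK hc hg
    rw [m0, m1, s0] at hm
    rw [weightedEnergy_of_affine hC hSw (hK _ hSw) (a := m) fun t ht => by
      rw [(hc t ht).2, covariance_eq_of_affine hC hK hc hg ht, s0], hq b (by rw [← hm]; abel)]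

/-- All three regularizers penalize the control quadratically. -/
theorem divergence_eq {m : ℕ} (r : Regularizer) {lam : ℝ} (hlam : 0 < lam)
    {Sw : Matrix (Fin n) (Fin n) ℝ} (hSw : Sw.PosDef) (B : Matrix (Fin n) (Fin m) ℝ)
    (a : Euc n) (u : Euc m) :
    r.divergence lam (multivariateGaussian (a + act B u) Sw) (multivariateGaussian a Sw) =
      ENNReal.ofReal (1 / 2 * qf (r.penalty lam B Sw) u.ofLp) := by
  have hlam' : ∀ S : Matrix (Fin n) (Fin n) ℝ, S.PosDef →
      (S + lam • (1 : Matrix (Fin n) (Fin n) ℝ)).PosDef := fun S hS =>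
    hS.add (Matrix.PosDef.one.smul hlam)
  cases r with
  | KL =>
    rw [Regularizer.divergence, Regularizer.penalty, klDiv_multivariateGaussian hSw, qf_conj,
      ofLp_act]
  | WKL =>
    rw [Regularizer.divergence, Regularizer.penalty, gaussianDivergence_eq (K := fun _ => 1)
      (fun _ _ _ => rfl) (fun _ _ => Matrix.PosDef.one) hSw, ofLp_act, inv_one,
      qf_transpose_mul_self]
  | KW =>
    rw [Regularizer.divergence, Regularizer.penalty, gaussianDivergence_eq
      (K := fun S => S + lam • 1) (fun a S hS => by
        rw [kalmanMobility, covMatrix_multivariateGaussian hS.posSemidef]) hlam' hSw, qf_conj,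
      ofLp_act]

lemma posDef_regularizer_penalty {m : ℕ} (r : Regularizer) {lam : ℝ} (hlam : 0 < lam)
    {Sw : Matrix (Fin n) (Fin n) ℝ} (hSw : Sw.PosDef) {B : Matrix (Fin n) (Fin m) ℝ}
    (hB : B.rank = m) : (r.penalty lam B Sw).PosDef := by
  cases r with
  | KL => exact posDef_conj_of_rank hB hSw.inv
  | WKL => simpa [Regularizer.penalty] using posDef_conj_of_rank hB .one
  | KW => exact posDef_conj_of_rank hB (hSw.add (Matrix.PosDef.one.smul hlam)).inv

end Divergence

/-! ### Second moments of the closed loop -/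

section ClosedLoop

variable {n m : ℕ} {Ω : Type*} {x₀ : Ω → Euc n} {w : ℕ → Ω → Euc n}
  {A : Matrix (Fin n) (Fin n) ℝ} {B : Matrix (Fin n) (Fin m) ℝ} {F : Matrix (Fin m) (Fin n) ℝ}

lemma trajectory_succ (x : Euc n) (v : ℕ → Euc n) (t : ℕ) :
    trajectory A B F x v (t + 1) = act (A + B * F) (trajectory A B F x v t) + v t := by
  simp only [trajectory, act_eq, Matrix.add_mulVec, ← Matrix.mulVec_mulVec]
  rfl

/-- The closed-loop state process. -/
noncomputable def closedLoop (A : Matrix (Fin n) (Fin n) ℝ) (B : Matrix (Fin n) (Fin m) ℝ)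
    (F : Matrix (Fin m) (Fin n) ℝ) (x₀ : Ω → Euc n) (w : ℕ → Ω → Euc n) (t : ℕ) (o : Ω) : Euc n :=
  trajectory A B F (x₀ o) (fun s => w s o) t

lemma closedLoop_succ (t : ℕ) : closedLoop A B F x₀ w (t + 1) =
    fun o => act (A + B * F) (closedLoop A B F x₀ w t o) + w t o :=
  funext fun _ => trajectory_succ _ _ _

end ClosedLoop

section Moments

variable {n m : ℕ} {Ω : Type*} [MeasurableSpace Ω] {Pr : Measure Ω}
  {S₀ Sw : Matrix (Fin n) (Fin n) ℝ} {x₀ : Ω → Euc n} {w : ℕ → Ω → Euc n}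
  {A : Matrix (Fin n) (Fin n) ℝ} {B : Matrix (Fin n) (Fin m) ℝ} {F : Matrix (Fin m) (Fin n) ℝ}

lemma memLp_act {f : Ω → Euc n} (hf : MemLp f 2 Pr) (M : Matrix (Fin m) (Fin n) ℝ) :
    MemLp (fun o => act M (f o)) 2 Pr :=
  (Matrix.toEuclideanLin M).toContinuousLinearMap.comp_memLp' hf

lemma memLp_of_map_eq {f : Ω → Euc n} (hf : Measurable f) {μ : Measure (Euc n)} [IsGaussian μ]
    (h : Pr.map f = μ) : MemLp f 2 Pr := by
  have h1 : MemLp (id : Euc n → Euc n) 2 (Pr.map f) := by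
    rw [h]; exact IsGaussian.memLp_two_id
  exact h1.comp_of_map hf.aemeasurable

lemma integrable_inner_of_memLp {f g : Ω → Euc n} (hf : MemLp f 2 Pr) (hg : MemLp g 2 Pr) :
    Integrable (fun o => (inner ℝ (f o) (g o) : ℝ)) Pr := by
  refine ((hf.norm.integrable_mul hg.norm)).mono'
    (hf.1.inner hg.1) (Eventually.of_forall fun o => ?_)
  exact norm_inner_le_norm _ _

lemma integrable_qf_of_memLp {f : Ω → Euc n} (hf : MemLp f 2 Pr)
    (W : Matrix (Fin n) (Fin n) ℝ) : Integrable (fun o => qf W (f o).ofLp) Pr := by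
  simpa only [inner_act_self] using integrable_inner_of_memLp hf (memLp_act hf W)

lemma memLp_coord {f : Ω → Euc n} (hf : MemLp f 2 Pr) (i : Fin n) :
    MemLp (fun o => f o i) 2 Pr :=
  (EuclideanSpace.proj (𝕜 := ℝ) i).comp_memLp' hf

lemma integral_inner_eq_zero [IsProbabilityMeasure Pr] {f g : Ω → Euc n} (hf : MemLp f 2 Pr)
    (hg : MemLp g 2 Pr) (hfg : IndepFun f g Pr) (h0 : ∫ o, g o ∂Pr = 0) :
    ∫ o, (inner ℝ (f o) (g o) : ℝ) ∂Pr = 0 := by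
  simp only [inner_eq_dotProduct, dotProduct]
  rw [integral_finsetSum]
  · refine Finset.sum_eq_zero fun i _ => ?_
    have hi : IndepFun (fun o => f o i) (fun o => g o i) Pr :=
      hfg.comp (φ := fun x : Euc n => x i) (ψ := fun x : Euc n => x i) (by fun_prop) (by fun_prop)
    have h1 : ∫ o, g o i ∂Pr = 0 := by
      have := (EuclideanSpace.proj (𝕜 := ℝ) i).integral_comp_comm (hg.integrable one_le_two)
      rw [h0] at this
      simpa using this
    rw [hi.integral_fun_mul_eq_mul_integral (memLp_coord hf i).1 (memLp_coord hg i).1, h1,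
      mul_zero]
  · exact fun i _ => (memLp_coord hf i).integrable_mul (memLp_coord hg i)

/-- The mean of a quadratic form of a centered Gaussian vector. -/
lemma integral_qf_multivariateGaussian (hSw : Sw.PosSemidef) (W : Matrix (Fin n) (Fin n) ℝ) :
    ∫ x : Euc n, qf W x.ofLp ∂(multivariateGaussian 0 Sw) = (W * Sw).trace := by
  have hL : MemLp (fun x : Euc n => x) 2 (multivariateGaussian 0 Sw) := IsGaussian.memLp_two_fun_id
  have hij : ∀ i j, ∫ x : Euc n, x i * x j ∂(multivariateGaussian 0 Sw) = Sw i j := by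
    intro i j
    rw [← covariance_eval_multivariateGaussian (μ := 0) hSw i j,
      covariance_eq_sub (memLp_coord hL i) (memLp_coord hL j)]
    have h1 : ∀ i, ∫ x : Euc n, x i ∂(multivariateGaussian 0 Sw) = 0 := fun i => by
      have := (EuclideanSpace.proj (𝕜 := ℝ) i).integral_comp_comm (hL.integrable one_le_two)
      rw [integral_id_multivariateGaussian] at this
      simpa using this
    simp [h1]
  have hint : ∀ i j, Integrable (fun x : Euc n => x i * (W i j * x j))
      (multivariateGaussian 0 Sw) := fun i j =>
    (memLp_coord hL i).integrable_mul ((memLp_coord hL j).const_mul (W i j))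
  simp only [qf, dotProduct, Matrix.mulVec, Finset.mul_sum]
  rw [integral_finsetSum _ fun i _ => integrable_finsetSum _ fun j _ => hint i j]
  simp only [Matrix.trace, Matrix.diag, Matrix.mul_apply]
  refine Finset.sum_congr rfl fun i _ => ?_
  rw [integral_finsetSum _ fun j _ => hint i j]
  refine Finset.sum_congr rfl fun j _ => ?_
  have e : ∀ x : Euc n, x i * (W i j * x j) = W i j * (x i * x j) := fun x => by ring
  simp only [e]
  rw [integral_const_mul, hij, (isSymm_of_posSemidef hSw).apply]

namespace IsGaussianModel

lemma memLp_noise (h : IsGaussianModel Pr S₀ Sw x₀ w) (t : ℕ) : MemLp (w t) 2 Pr :=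
  memLp_of_map_eq (h.measurable_noise t) (h.law_noise t)

lemma memLp_closedLoop (h : IsGaussianModel Pr S₀ Sw x₀ w) (t : ℕ) :
    MemLp (closedLoop A B F x₀ w t) 2 Pr := by
  induction t with
  | zero => exact memLp_of_map_eq h.measurable_init h.law_init
  | succ t ih =>
    rw [closedLoop_succ]
    exact (memLp_act ih _).add (h.memLp_noise t)

lemma integral_noise (h : IsGaussianModel Pr S₀ Sw x₀ w) (t : ℕ) : ∫ o, w t o ∂Pr = 0 := by
  have := integral_map (μ := Pr) (h.measurable_noise t).aemeasurable
    (f := fun x : Euc n => x) (by fun_prop)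
  rw [h.law_noise, integral_id_multivariateGaussian] at this
  exact this.symm

/-- The state at time `t` involves only the initial state and the noises before `t`. Unrolling the
linear recursion inside the integral requires only pairwise independence; for this the matrix `M`
and the later time `r` stay universally quantified. -/
lemma integral_inner_closedLoop_noise [IsProbabilityMeasure Pr]
    (h : IsGaussianModel Pr S₀ Sw x₀ w) (t : ℕ) :
    ∀ r, t ≤ r → ∀ M : Matrix (Fin n) (Fin n) ℝ,
      ∫ o, (inner ℝ (act M (closedLoop A B F x₀ w t o)) (w r o) : ℝ) ∂Pr = 0 := by
  induction t with
  | zero =>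
    intro r _ M
    have hi : IndepFun x₀ (w r) Pr :=
      h.indep_init.comp (φ := id) (ψ := fun v : ℕ → Euc n => v r) measurable_id
        (measurable_pi_apply r)
    refine integral_inner_eq_zero (memLp_act (h.memLp_closedLoop 0) M) (h.memLp_noise r) ?_
      (h.integral_noise r)
    exact hi.comp (φ := act M) (ψ := id) (continuous_act M).measurable measurable_id
  | succ t ih =>
    intro r hr M
    have hi : IndepFun (w t) (w r) Pr := h.indep_noise.indepFun (by omega)
    have h1 : ∫ o, (inner ℝ (act M (w t o)) (w r o) : ℝ) ∂Pr = 0 :=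
      integral_inner_eq_zero (memLp_act (h.memLp_noise t) M) (h.memLp_noise r)
        (hi.comp (φ := act M) (ψ := id) (continuous_act M).measurable measurable_id)
        (h.integral_noise r)
    have e : ∀ o, (inner ℝ (act M (closedLoop A B F x₀ w (t + 1) o)) (w r o) : ℝ) =
        inner ℝ (act (M * (A + B * F)) (closedLoop A B F x₀ w t o)) (w r o) +
          inner ℝ (act M (w t o)) (w r o) := fun o => by
      rw [closedLoop_succ, ← inner_add_left]
      congr 1
      simp only [act_eq, WithLp.ofLp_add, Matrix.mulVec_add, Matrix.mulVec_mulVec]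
      rfl
    simp only [e]
    rw [integral_add (integrable_inner_of_memLp (memLp_act (h.memLp_closedLoop t) _)
        (h.memLp_noise r)) (integrable_inner_of_memLp (memLp_act (h.memLp_noise t) _)
        (h.memLp_noise r)), h1, ih r (by omega), add_zero]

lemma integral_qf_noise (h : IsGaussianModel Pr S₀ Sw x₀ w) (hSw : Sw.PosSemidef)
    (W : Matrix (Fin n) (Fin n) ℝ) (t : ℕ) : ∫ o, qf W (w t o).ofLp ∂Pr = (W * Sw).trace := by
  have := integral_map (μ := Pr) (h.measurable_noise t).aemeasurable
    (f := fun x : Euc n => qf W x.ofLp) (by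
      simp only [← inner_act_self]; fun_prop)
  rw [h.law_noise, integral_qf_multivariateGaussian hSw] at this
  exact this.symm

/-- The recursion for the second moments of the closed loop. -/
theorem integral_qf_closedLoop_succ [IsProbabilityMeasure Pr]
    (h : IsGaussianModel Pr S₀ Sw x₀ w) (hSw : Sw.PosSemidef) {W : Matrix (Fin n) (Fin n) ℝ}
    (hW : W.IsSymm) (t : ℕ) :
    ∫ o, qf W (closedLoop A B F x₀ w (t + 1) o).ofLp ∂Pr =
      ∫ o, qf W ((A + B * F) *ᵥ (closedLoop A B F x₀ w t o).ofLp) ∂Pr + (W * Sw).trace := by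
  have e : ∀ o, qf W (closedLoop A B F x₀ w (t + 1) o).ofLp =
      qf W (act (A + B * F) (closedLoop A B F x₀ w t o)).ofLp +
        2 * inner ℝ (act (W * (A + B * F)) (closedLoop A B F x₀ w t o)) (w t o) +
        qf W (w t o).ofLp := fun o => by
    rw [closedLoop_succ, WithLp.ofLp_add, qf_add_right hW, inner_eq_dotProduct, ofLp_act, ofLp_act,
      ← Matrix.mulVec_mulVec, Matrix.dotProduct_mulVec _ W, ← Matrix.mulVec_transpose, hW]
  have i1 := integrable_qf_of_memLp
    (memLp_act (h.memLp_closedLoop (A := A) (B := B) (F := F) t) (A + B * F)) W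
  have i2 := (integrable_inner_of_memLp (memLp_act
    (h.memLp_closedLoop (A := A) (B := B) (F := F) t) (W * (A + B * F)))
    (h.memLp_noise t)).const_mul 2
  simp only [e]
  rw [integral_add (by exact i1.add i2) (integrable_qf_of_memLp (h.memLp_noise t) W),
    integral_add i1 i2,
    integral_const_mul, h.integral_inner_closedLoop_noise t t le_rfl, h.integral_qf_noise hSw]
  simp [ofLp_act]

end IsGaussianModel

end Moments

/-! ### The regularized cost -/

section Cost

variable {n m p : ℕ} {Ω : Type*} [MeasurableSpace Ω] {Pr : Measure Ω} [IsProbabilityMeasure Pr]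
  {S₀ Sw : Matrix (Fin n) (Fin n) ℝ} {x₀ : Ω → Euc n} {w : ℕ → Ω → Euc n} {γ : ℝ}
  {A : Matrix (Fin n) (Fin n) ℝ} {B : Matrix (Fin n) (Fin m) ℝ} {Q : Matrix (Fin n) (Fin n) ℝ}
  {R : Matrix (Fin m) (Fin m) ℝ} {F : Matrix (Fin m) (Fin n) ℝ}

/-- The second moment functional `W ↦ 𝔼[x_tᵀ W x_t]` of the closed loop. -/
noncomputable def moment (Pr : Measure Ω) (A : Matrix (Fin n) (Fin n) ℝ)
    (B : Matrix (Fin n) (Fin m) ℝ) (F : Matrix (Fin m) (Fin n) ℝ) (x₀ : Ω → Euc n)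
    (w : ℕ → Ω → Euc n) (t : ℕ) (W : Matrix (Fin n) (Fin n) ℝ) : ℝ :=
  ∫ o, qf W (closedLoop A B F x₀ w t o).ofLp ∂Pr

omit [IsProbabilityMeasure Pr] in
lemma moment_nonneg {W : Matrix (Fin n) (Fin n) ℝ} (hW : W.PosSemidef) (t : ℕ) :
    0 ≤ moment Pr A B F x₀ w t W :=
  integral_nonneg fun _ => qf_nonneg hW _

omit [IsProbabilityMeasure Pr] in
lemma moment_mono (h : IsGaussianModel Pr S₀ Sw x₀ w) {W W' : Matrix (Fin n) (Fin n) ℝ}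
    (hW : ∀ x, qf W x ≤ qf W' x) (t : ℕ) :
    moment Pr A B F x₀ w t W ≤ moment Pr A B F x₀ w t W' :=
  integral_mono (integrable_qf_of_memLp (h.memLp_closedLoop t) W)
    (integrable_qf_of_memLp (h.memLp_closedLoop t) W') fun _ => hW _

omit [IsProbabilityMeasure Pr] in
lemma moment_add (h : IsGaussianModel Pr S₀ Sw x₀ w) (W W' : Matrix (Fin n) (Fin n) ℝ) (t : ℕ) :
    moment Pr A B F x₀ w t (W + W') =
      moment Pr A B F x₀ w t W + moment Pr A B F x₀ w t W' := by
  simp only [moment, qf_add]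
  exact integral_add (integrable_qf_of_memLp (h.memLp_closedLoop t) W)
    (integrable_qf_of_memLp (h.memLp_closedLoop t) W')

omit [IsProbabilityMeasure Pr] in
lemma moment_smul (c : ℝ) (W : Matrix (Fin n) (Fin n) ℝ) (t : ℕ) :
    moment Pr A B F x₀ w t (c • W) = c * moment Pr A B F x₀ w t W := by
  simp only [moment, qf_smul]
  exact integral_const_mul _ _

lemma moment_succ (h : IsGaussianModel Pr S₀ Sw x₀ w) (hSw : Sw.PosSemidef)
    {W : Matrix (Fin n) (Fin n) ℝ} (hW : W.IsSymm) (t : ℕ) :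
    moment Pr A B F x₀ w (t + 1) W =
      moment Pr A B F x₀ w t ((A + B * F)ᵀ * W * (A + B * F)) + (W * Sw).trace := by
  simp only [moment, qf_conj]
  exact h.integral_qf_closedLoop_succ hSw hW t

lemma trace_mul_nonneg {W : Matrix (Fin n) (Fin n) ℝ} (hW : W.PosSemidef) (hSw : Sw.PosSemidef) :
    0 ≤ (W * Sw).trace := by
  rw [← integral_qf_multivariateGaussian hSw]
  exact integral_nonneg fun _ => qf_nonneg hW _

lemma posSemidef_stage (hQ : Q.PosSemidef) (hR : R.PosDef) (F : Matrix (Fin m) (Fin n) ℝ) :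
    (Q + Fᵀ * R * F).PosSemidef := by
  have := hR.posSemidef.conjTranspose_mul_mul_same F
  rw [Matrix.conjTranspose_eq_transpose_of_trivial] at this
  exact hQ.add this

omit [IsProbabilityMeasure Pr] in
/-- The regularized cost is a series of second moments. -/
theorem regularizedCost_eq (h : IsGaussianModel Pr S₀ Sw x₀ w) (r : Regularizer) {lam : ℝ}
    (hlam : 0 < lam) (hSw : Sw.PosDef) (hB : B.rank = m) (hγ : 0 ≤ γ) (hQ : Q.PosSemidef)
    (F : Matrix (Fin m) (Fin n) ℝ) :
    regularizedCost Pr x₀ w r lam γ A B Q Sw F = ∑' t : ℕ, ENNReal.ofReal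
      (γ ^ t * (1 / 2 * moment Pr A B F x₀ w t (Q + Fᵀ * r.penalty lam B Sw * F))) := by
  have hR := posDef_regularizer_penalty r hlam hSw hB
  have e : ∀ t o, ENNReal.ofReal (γ ^ t) *
      stageCost r lam A B Q Sw (trajectory A B F (x₀ o) (fun s => w s o) t)
        (act F (trajectory A B F (x₀ o) (fun s => w s o) t)) =
      ENNReal.ofReal (γ ^ t * (1 / 2 * qf (Q + Fᵀ * r.penalty lam B Sw * F)
        (closedLoop A B F x₀ w t o).ofLp)) := by
    intro t o
    rw [stageCost, divergence_eq r hlam hSw, inner_act_self, ← ENNReal.ofReal_add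
      (mul_nonneg (by norm_num) (qf_nonneg hQ _))
      (mul_nonneg (by norm_num) (qf_nonneg hR.posSemidef _)),
      ← ENNReal.ofReal_mul (by positivity), qf_add, qf_conj, ofLp_act, closedLoop, mul_add]
    congr 1
    ring
  have hi : ∀ t, Integrable (fun o => γ ^ t * (1 / 2 * qf (Q + Fᵀ * r.penalty lam B Sw * F)
      (closedLoop A B F x₀ w t o).ofLp)) Pr := fun t =>
    ((integrable_qf_of_memLp (h.memLp_closedLoop t) _).const_mul _).const_mul _
  simp only [regularizedCost, e]
  rw [lintegral_tsum fun t => (hi t).1.aemeasurable.ennreal_ofReal]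
  refine tsum_congr fun t => ?_
  rw [← ofReal_integral_eq_lintegral_ofReal (hi t), integral_const_mul, integral_const_mul, moment]
  exact Eventually.of_forall fun o => mul_nonneg (by positivity)
    (mul_nonneg (by norm_num) (qf_nonneg (posSemidef_stage hQ hR F) _))

/-- Completion of squares along the closed loop. -/
lemma discounted_moment_eq (h : IsGaussianModel Pr S₀ Sw x₀ w) (hSw : Sw.PosSemidef) (hγ : 0 ≤ γ)
    (hR : R.PosDef) {P : Matrix (Fin n) (Fin n) ℝ} (hP : P.PosSemidef)
    (hE : riccatiOp γ A B Q R P = P) (t : ℕ) :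
    γ ^ t * moment Pr A B F x₀ w t (Q + Fᵀ * R * F) =
      γ ^ t * moment Pr A B F x₀ w t P - γ ^ (t + 1) * moment Pr A B F x₀ w (t + 1) P +
      γ ^ t * γ * (P * Sw).trace + γ ^ t * moment Pr A B F x₀ w t
        ((F - riccatiGain γ A B R P)ᵀ * (R + γ • (Bᵀ * P * B)) * (F - riccatiGain γ A B R P)) := by
  have e : moment Pr A B F x₀ w t ((Q + Fᵀ * R * F) + γ • ((A + B * F)ᵀ * P * (A + B * F))) =
      moment Pr A B F x₀ w t (P +
        (F - riccatiGain γ A B R P)ᵀ * (R + γ • (Bᵀ * P * B)) * (F - riccatiGain γ A B R P)) := by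
    unfold moment
    congr 1
    ext1 o
    have := bellman_eq (A := A) (B := B) (Q := Q) hγ hR hP F (closedLoop A B F x₀ w t o).ofLp
    rw [hE, bellman] at this
    simpa only [qf_add, qf_smul, qf_conj] using this
  rw [moment_add h (Q + _), moment_add h P, moment_smul] at e
  rw [moment_succ h hSw (isSymm_of_posSemidef hP)]
  linear_combination (γ ^ t) * e

/-- Finite cost forces the discounted second moments to vanish. -/
lemma tendsto_discounted_moment (h : IsGaussianModel Pr S₀ Sw x₀ w) (hSw : Sw.PosSemidef)
    (hγ : 0 ≤ γ) (hγ₁ : γ < 1) (hR : R.PosDef) {C : Matrix (Fin p) (Fin n) ℝ} (hC : Cᵀ * C = Q)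
    {L : Matrix (Fin n) (Fin p) ℝ} (hL : LyapunovStable γ (A + L * C))
    (hs : Summable fun t => γ ^ t * moment Pr A B F x₀ w t (Q + Fᵀ * R * F))
    {P : Matrix (Fin n) (Fin n) ℝ} (hP : P.PosSemidef) :
    Tendsto (fun t => γ ^ t * moment Pr A B F x₀ w t P) atTop (𝓝 0) := by
  obtain ⟨X, hX, θ, c, h0, h1, hc, hx⟩ := exists_lyapunov_of_detectable (B := B) hγ hR hL F
  rw [hC] at hx
  set y : ℕ → ℝ := fun t => γ ^ t * moment Pr A B F x₀ w t X with hy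
  have hy0 : ∀ t, 0 ≤ y t := fun t => mul_nonneg (by positivity) (moment_nonneg hX.posSemidef t)
  -- A contraction driven by a summable source, namely the stage costs and the geometric noise
  -- terms; the nonnegative sequence `y` is then summable and tends to zero.
  have hstep : ∀ t, y (t + 1) ≤ θ * y t + (c * (γ ^ t * moment Pr A B F x₀ w t (Q + Fᵀ * R * F)) +
      γ ^ t * (γ * (X * Sw).trace)) := by
    intro t
    have e : γ * moment Pr A B F x₀ w t ((A + B * F)ᵀ * X * (A + B * F)) ≤
        θ * moment Pr A B F x₀ w t X + c * moment Pr A B F x₀ w t (Q + Fᵀ * R * F) := by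
      rw [← moment_smul, ← moment_smul, ← moment_smul, ← moment_add h]
      refine moment_mono h (fun x => ?_) t
      simpa only [qf_add, qf_smul, qf_conj] using hx x
    have e2 := mul_le_mul_of_nonneg_left e (pow_nonneg hγ t)
    simp only [hy]
    rw [moment_succ h hSw (isSymm_of_posSemidef hX.posSemidef), pow_succ]
    linarith
  have hz : Summable fun t => c * (γ ^ t * moment Pr A B F x₀ w t (Q + Fᵀ * R * F)) +
      γ ^ t * (γ * (X * Sw).trace) :=
    (hs.mul_left c).add ((summable_geometric_of_lt_one hγ hγ₁).mul_right _)
  have hy1 : Summable y := by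
    have hz0 : ∀ t, 0 ≤ c * (γ ^ t * moment Pr A B F x₀ w t (Q + Fᵀ * R * F)) +
        γ ^ t * (γ * (X * Sw).trace) := fun t => by
      have e1 := (hy0 (t + 1)).trans (hstep t)
      have e2 : 0 ≤ (X * Sw).trace := trace_mul_nonneg hX.posSemidef hSw
      have e3 : 0 ≤ moment Pr A B F x₀ w t (Q + Fᵀ * R * F) := by
        refine moment_nonneg (posSemidef_stage ?_ hR F) t
        rw [← hC, ← Matrix.conjTranspose_eq_transpose_of_trivial]
        exact Matrix.posSemidef_conjTranspose_mul_self C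
      positivity
    -- Summing `hstep` bounds `(1 - θ) ∑ y` by `y 0` plus the total source.
    refine summable_of_sum_range_le (c := (y 0 + ∑' t, (c * (γ ^ t * moment Pr A B F x₀ w t
      (Q + Fᵀ * R * F)) + γ ^ t * (γ * (X * Sw).trace))) / (1 - θ)) hy0 fun N => ?_
    rw [le_div_iff₀ (by linarith)]
    have e1 : ∑ t ∈ Finset.range N, y (t + 1) ≤ θ * ∑ t ∈ Finset.range N, y t +
        ∑ t ∈ Finset.range N, (c * (γ ^ t * moment Pr A B F x₀ w t (Q + Fᵀ * R * F)) +
          γ ^ t * (γ * (X * Sw).trace)) := by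
      rw [Finset.mul_sum, ← Finset.sum_add_distrib]
      exact Finset.sum_le_sum fun t _ => hstep t
    have e2 := hz.sum_le_tsum (Finset.range N) fun t _ => hz0 t
    have e3 := Finset.sum_range_succ' y N
    have e4 := Finset.sum_range_succ y N
    have e5 := hy0 N
    linarith
  obtain ⟨k, hk, hkP⟩ := qf_le_mul_qf P hX
  refine squeeze_zero (fun t => mul_nonneg (by positivity) (moment_nonneg hP t)) (fun t => ?_)
    (by simpa using hy1.tendsto_atTop_zero.const_mul k)
  have e : moment Pr A B F x₀ w t P ≤ k * moment Pr A B F x₀ w t X := by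
    rw [← moment_smul]
    exact moment_mono h (fun x => by simpa only [qf_smul] using hkP x) t
  calc _ ≤ γ ^ t * (k * moment Pr A B F x₀ w t X) := by gcongr
    _ = k * y t := by simp only [hy]; ring

/-- The Riccati gain has finite cost and is the unique optimal gain. -/
theorem regularizedCost_riccatiGain_lt (h : IsGaussianModel Pr S₀ Sw x₀ w) (r : Regularizer)
    {lam : ℝ} (hlam : 0 < lam) (hSw : Sw.PosDef) (hB : B.rank = m) (hγ : 0 < γ) (hγ₁ : γ < 1)
    (hQ : Q.PosSemidef) {C : Matrix (Fin p) (Fin n) ℝ} (hC : Cᵀ * C = Q)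
    {L : Matrix (Fin n) (Fin p) ℝ} (hL : LyapunovStable γ (A + L * C))
    {P : Matrix (Fin n) (Fin n) ℝ} (hP : P.PosSemidef)
    (hE : riccatiOp γ A B Q (r.penalty lam B Sw) P = P) :
    regularizedCost Pr x₀ w r lam γ A B Q Sw (riccatiGain γ A B (r.penalty lam B Sw) P) < ⊤ ∧
    ∀ F : Matrix (Fin m) (Fin n) ℝ, F ≠ riccatiGain γ A B (r.penalty lam B Sw) P →
      regularizedCost Pr x₀ w r lam γ A B Q Sw (riccatiGain γ A B (r.penalty lam B Sw) P) <
        regularizedCost Pr x₀ w r lam γ A B Q Sw F := by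
  have hR := posDef_regularizer_penalty r hlam hSw hB
  set R := r.penalty lam B Sw with hRdef
  set F₀ := riccatiGain γ A B R P with hF₀
  have hps := hSw.posSemidef
  have hH := posDef_penalty hγ.le hR hP B
  set ν := (P * Sw).trace with hν
  have hν0 : 0 ≤ ν := trace_mul_nonneg hP hps
  set p₀ := ∫ o, qf P (x₀ o).ofLp ∂Pr
  have hm0 : ∀ F : Matrix (Fin m) (Fin n) ℝ, moment Pr A B F x₀ w 0 P = p₀ := fun F => rfl
  -- Half of `V` bounds the cost of `F₀` from above: initial value plus the discounted noise
  -- contributions.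
  set V := p₀ + γ * ν / (1 - γ) with hV
  have hgeo := hasSum_geometric_of_lt_one hγ.le hγ₁
  have hνsum : HasSum (fun t : ℕ => γ ^ t * γ * ν) (γ * ν / (1 - γ)) := by
    have := hgeo.mul_right (γ * ν)
    simpa only [mul_assoc, inv_mul_eq_div] using this
  have hsum : ∀ (F : Matrix (Fin m) (Fin n) ℝ) (N : ℕ),
      ∑ t ∈ Finset.range N, γ ^ t * moment Pr A B F x₀ w t (Q + Fᵀ * R * F) =
        p₀ - γ ^ N * moment Pr A B F x₀ w N P + ∑ t ∈ Finset.range N, γ ^ t * γ * ν +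
        ∑ t ∈ Finset.range N, γ ^ t * moment Pr A B F x₀ w t
          ((F - F₀)ᵀ * (R + γ • (Bᵀ * P * B)) * (F - F₀)) := by
    intro F N
    rw [Finset.sum_congr rfl fun t _ => discounted_moment_eq h hps hγ.le hR hP hE t,
      Finset.sum_add_distrib, Finset.sum_add_distrib,
      Finset.sum_range_sub' (fun t => γ ^ t * moment Pr A B F x₀ w t P)]
    simp only [pow_zero, one_mul, hm0]
    rfl
  have hW0 : ∀ (F : Matrix (Fin m) (Fin n) ℝ) (t : ℕ),
      0 ≤ γ ^ t * moment Pr A B F x₀ w t (Q + Fᵀ * R * F) := fun F t =>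
    mul_nonneg (by positivity) (moment_nonneg (posSemidef_stage hQ hR F) t)
  have hcost := fun F => regularizedCost_eq (A := A) h r hlam hSw hB hγ.le hQ F
  have ehalf : ∀ a b : ℝ, a * (1 / 2 * b) = 1 / 2 * (a * b) := fun a b => by ring
  simp only [← hRdef, ehalf] at hcost
  have hbound : ∀ N : ℕ, ∑ t ∈ Finset.range N,
      γ ^ t * moment Pr A B F₀ x₀ w t (Q + F₀ᵀ * R * F₀) ≤ V := by
    intro N
    rw [hsum]
    have e1 := hνsum.summable.sum_le_tsum (Finset.range N) fun t _ => by positivity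
    rw [hνsum.tsum_eq] at e1
    have e2 : 0 ≤ γ ^ N * moment Pr A B F₀ x₀ w N P :=
      mul_nonneg (by positivity) (moment_nonneg hP N)
    have e3 : ∑ t ∈ Finset.range N, γ ^ t * moment Pr A B F₀ x₀ w t
        ((F₀ - F₀)ᵀ * (R + γ • (Bᵀ * P * B)) * (F₀ - F₀)) = 0 := by
      simp [moment, qf]
    rw [e3]
    linarith
  have hopt : regularizedCost Pr x₀ w r lam γ A B Q Sw F₀ ≤ ENNReal.ofReal (1 / 2 * V) := by
    rw [hcost]
    refine ENNReal.tsum_le_of_sum_range_le fun N => ?_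
    rw [← ENNReal.ofReal_sum_of_nonneg fun t _ => mul_nonneg (by norm_num) (hW0 F₀ t),
      ← Finset.mul_sum]
    exact ENNReal.ofReal_le_ofReal (by linarith [hbound N])
  refine ⟨hopt.trans_lt ENNReal.ofReal_lt_top, fun F hF => ?_⟩
  by_cases htop : regularizedCost Pr x₀ w r lam γ A B Q Sw F = ⊤
  · rw [htop]; exact hopt.trans_lt ENNReal.ofReal_lt_top
  refine hopt.trans_lt ?_
  have hs2 : Summable fun t => 1 / 2 * (γ ^ t * moment Pr A B F x₀ w t (Q + Fᵀ * R * F)) := by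
    rw [hcost] at htop
    have := ENNReal.summable_toReal htop
    refine this.congr fun t => ?_
    rw [ENNReal.toReal_ofReal (mul_nonneg (by norm_num) (hW0 F t))]
  have hs : Summable fun t => γ ^ t * moment Pr A B F x₀ w t (Q + Fᵀ * R * F) :=
    (hs2.mul_left 2).congr fun t => by ring
  rw [hcost, ← ENNReal.ofReal_tsum_of_nonneg (fun t => mul_nonneg (by norm_num) (hW0 F t)) hs2,
    tsum_mul_left]
  have hΔ : ((F - F₀)ᵀ * (R + γ • (Bᵀ * P * B)) * (F - F₀)).PosSemidef := by
    have := hH.posSemidef.conjTranspose_mul_mul_same (F - F₀)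
    rwa [Matrix.conjTranspose_eq_transpose_of_trivial] at this
  set Δ := (F - F₀)ᵀ * (R + γ • (Bᵀ * P * B)) * (F - F₀) with hΔdef
  have hΔpos : 0 < (Δ * Sw).trace := trace_conj_mul_pos hH hSw (sub_ne_zero.2 hF)
  -- Time one is used, not time zero, because the initial covariance may be singular; by then the
  -- nondegenerate noise has entered the state.
  have hm1 : 0 < γ ^ 1 * moment Pr A B F x₀ w 1 Δ := by
    have e1 : 0 ≤ moment Pr A B F x₀ w 0 ((A + B * F)ᵀ * Δ * (A + B * F)) := by
      refine moment_nonneg ?_ 0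
      have := hΔ.conjTranspose_mul_mul_same (A + B * F)
      rwa [Matrix.conjTranspose_eq_transpose_of_trivial] at this
    have e2 := moment_succ (F := F) (A := A) (B := B) h hps (isSymm_of_posSemidef hΔ) 0
    rw [zero_add] at e2
    rw [e2]
    positivity
  have hlim := tendsto_discounted_moment h hps hγ.le hγ₁ hR hC hL hs hP
  have hge : V + γ ^ 1 * moment Pr A B F x₀ w 1 Δ ≤
      ∑' t, γ ^ t * moment Pr A B F x₀ w t (Q + Fᵀ * R * F) := by
    have t1 := ((tendsto_const_nhds (x := p₀)).sub hlim).add hνsum.tendsto_sum_nat |>.add_const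
      (γ ^ 1 * moment Pr A B F x₀ w 1 Δ)
    rw [sub_zero] at t1
    refine le_of_tendsto_of_tendsto t1 hs.hasSum.tendsto_sum_nat ?_
    -- From `N = 2` on, the partial sum contains the strictly positive term at time one.
    filter_upwards [eventually_ge_atTop 2] with N hN
    rw [hsum]
    gcongr
    exact Finset.single_le_sum (f := fun t => γ ^ t * moment Pr A B F x₀ w t Δ)
      (fun t _ => mul_nonneg (by positivity) (moment_nonneg hΔ t))
      (Finset.mem_range.2 (show 1 < N by omega))
  rw [ENNReal.ofReal_lt_ofReal_iff_of_nonneg]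
  · linarith
  · have : 0 ≤ p₀ := integral_nonneg fun o => qf_nonneg hP _
    have : 0 ≤ γ * ν / (1 - γ) := div_nonneg (by positivity) (by linarith)
    linarith

end Cost

/-! ### The Riccati solution and the gains -/

section Gain

variable {n m p : ℕ} {γ : ℝ} {A : Matrix (Fin n) (Fin n) ℝ} {B : Matrix (Fin n) (Fin m) ℝ}
  {Q : Matrix (Fin n) (Fin n) ℝ} {R : Matrix (Fin m) (Fin m) ℝ}

theorem existsUnique_solvesDARE (hγ : 0 < γ) (hQ : Q.PosSemidef) (hR : R.PosDef)
    {K : Matrix (Fin m) (Fin n) ℝ} (hK : LyapunovStable γ (A + B * K))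
    {C : Matrix (Fin p) (Fin n) ℝ} (hC : Cᵀ * C = Q) {L : Matrix (Fin n) (Fin p) ℝ}
    (hL : LyapunovStable γ (A + L * C)) :
    ∃! P : Matrix (Fin n) (Fin n) ℝ, P.PosSemidef ∧ SolvesDARE γ A B Q R P := by
  obtain ⟨P, hP, hE⟩ := exists_riccatiOp_eq hγ.le hQ hR hK
  refine ⟨P, ⟨hP, (solvesDARE_iff hγ hR hP).2 hE⟩, fun P' ⟨hP', hE'⟩ => ?_⟩
  exact riccatiOp_eq_unique hγ.le hR hC hL hP' hP ((solvesDARE_iff hγ hR hP').1 hE') hE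

lemma dareSolution_spec (hγ : 0 < γ) (hQ : Q.PosSemidef) (hR : R.PosDef)
    {K : Matrix (Fin m) (Fin n) ℝ} (hK : LyapunovStable γ (A + B * K)) :
    (dareSolution γ A B Q R).PosSemidef ∧
      riccatiOp γ A B Q R (dareSolution γ A B Q R) = dareSolution γ A B Q R := by
  obtain ⟨P, hP, hE⟩ := exists_riccatiOp_eq hγ.le hQ hR hK
  have h := Classical.epsilon_spec
    (p := fun P : Matrix (Fin n) (Fin n) ℝ => P.PosSemidef ∧ SolvesDARE γ A B Q R P)
    ⟨P, hP, (solvesDARE_iff hγ hR hP).2 hE⟩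
  exact ⟨h.1, (solvesDARE_iff hγ hR h.1).1 h.2⟩

lemma exists_lyapunovStable_of_stabilizable (hγ : γ ≤ 1) (h : IsStabilizable A B) :
    ∃ K : Matrix (Fin m) (Fin n) ℝ, LyapunovStable γ (A + B * K) :=
  h.imp fun _ hK => (lyapunovStable_of_specRadius_lt_one hK).mono hγ

lemma exists_lyapunovStable_of_detectable {C : Matrix (Fin p) (Fin n) ℝ} (hγ : γ ≤ 1)
    (h : IsDetectable A C) : ∃ L : Matrix (Fin n) (Fin p) ℝ, LyapunovStable γ (A + L * C) :=
  h.imp fun _ hL => (lyapunovStable_of_specRadius_lt_one hL).mono hγ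

lemma transpose_sqrt_mul_sqrt (hQ : Q.PosSemidef) : (CFC.sqrt Q)ᵀ * CFC.sqrt Q = Q := by
  have : (CFC.sqrt Q).IsSymm :=
    isSymm_of_posSemidef (Matrix.nonneg_iff_posSemidef.1 (CFC.sqrt_nonneg Q))
  rw [this]
  exact CFC.sqrt_mul_sqrt_self _ hQ.nonneg

lemma inv_smul_one {c : ℝ} (hc : c ≠ 0) :
    (c • (1 : Matrix (Fin n) (Fin n) ℝ))⁻¹ = c⁻¹ • 1 := by
  refine Matrix.inv_eq_right_inv ?_
  rw [Matrix.smul_mul, Matrix.mul_smul, smul_smul, mul_inv_cancel₀ hc, one_smul, Matrix.mul_one]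

lemma gain_KL_smul_one (lam : ℝ) {ρ : ℝ} (hρ : ρ ≠ 0) :
    Regularizer.KL.gain lam γ A B Q (ρ • 1) =
      riccatiGain γ A B (ρ⁻¹ • (Bᵀ * B)) (dareSolution γ A B Q (ρ⁻¹ • (Bᵀ * B))) := by
  simp [Regularizer.gain, Regularizer.penalty, inv_smul_one hρ]

lemma gain_KW_smul_one {ρ : ℝ} (hρ : ρ + 1 ≠ 0) :
    Regularizer.KW.gain 1 γ A B Q (ρ • 1) =
      riccatiGain γ A B ((ρ + 1)⁻¹ • (Bᵀ * B)) (dareSolution γ A B Q ((ρ + 1)⁻¹ • (Bᵀ * B))) := by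
  have e : (ρ • (1 : Matrix (Fin n) (Fin n) ℝ) + (1 : ℝ) • 1)⁻¹ = (ρ + 1)⁻¹ • 1 := by
    rw [← add_smul, inv_smul_one hρ]
  simp only [Regularizer.gain, Regularizer.penalty, e, Matrix.mul_smul, Matrix.smul_mul,
    Matrix.mul_one]

lemma gain_WKL (lam : ℝ) (Sw : Matrix (Fin n) (Fin n) ℝ) :
    Regularizer.WKL.gain lam γ A B Q Sw = riccatiGain γ A B ((1 : ℝ) • (Bᵀ * B))
      (dareSolution γ A B Q ((1 : ℝ) • (Bᵀ * B))) := by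
  simp [Regularizer.gain, Regularizer.penalty]

lemma riccatiGain_ne_zero (hγ : 0 < γ) (hR : R.PosDef) {P : Matrix (Fin n) (Fin n) ℝ}
    (hP : P.PosSemidef) (h : Bᵀ * P * A ≠ 0) : riccatiGain γ A B R P ≠ 0 := by
  intro h0
  have hdet := (Matrix.isUnit_iff_isUnit_det _).1 (posDef_penalty hγ.le hR hP B).isUnit
  rw [riccatiGain, neg_eq_zero, smul_eq_zero_iff_right hγ.ne'] at h0
  refine h ?_
  have := congrArg ((R + γ • (Bᵀ * P * B)) * ·) h0
  simpa only [← Matrix.mul_assoc, Matrix.mul_nonsing_inv _ hdet, Matrix.one_mul,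
    Matrix.mul_zero] using this

/-- The scalar system `A = B = Q = 1` serves for every `γ < 1`: its spectral radius `1` is below
`1/√γ`, the gains `-1` give `A + B K = A + L √Q = 0`, and `BᵀPA = P` is positive. -/
lemma exists_gain_WKL_ne_zero (hγ : 0 < γ) (hγ₁ : γ < 1) :
    ∃ (n' m' : ℕ) (A' : Matrix (Fin n') (Fin n') ℝ) (B' : Matrix (Fin n') (Fin m') ℝ)
      (Q' : Matrix (Fin n') (Fin n') ℝ),
      Q'.PosDef ∧ IsStabilizable A' B' ∧ IsDetectable A' (CFC.sqrt Q') ∧ B'.rank = m' ∧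
      specRadius A' < ENNReal.ofReal (1 / √γ) ∧
      Regularizer.WKL.gain 1 γ A' B' Q' 1 ≠ 0 := by
  have h0 : specRadius (0 : Matrix (Fin 1) (Fin 1) ℝ) < 1 := by
    simp [specRadius]
  have hst : IsStabilizable (1 : Matrix (Fin 1) (Fin 1) ℝ) (1 : Matrix (Fin 1) (Fin 1) ℝ) :=
    ⟨-1, by simpa using h0⟩
  have hone : (1 : Matrix (Fin 1) (Fin 1) ℝ).PosDef := Matrix.PosDef.one
  refine ⟨1, 1, 1, 1, 1, hone, hst, ⟨-1, by simpa using h0⟩, by simp, ?_, ?_⟩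
  · have h1 : specRadius (1 : Matrix (Fin 1) (Fin 1) ℝ) = 1 := by
      simp [specRadius, spectralRadius, spectrum.one_eq]
    rw [h1, ENNReal.one_lt_ofReal]
    exact (one_lt_div (Real.sqrt_pos.2 hγ)).2 ((Real.sqrt_lt' one_pos).2 (by simpa using hγ₁))
  · obtain ⟨K, hK⟩ := exists_lyapunovStable_of_stabilizable hγ₁.le hst
    rw [gain_WKL]
    have hR : ((1 : ℝ) • ((1 : Matrix (Fin 1) (Fin 1) ℝ)ᵀ * 1)).PosDef := by simpa using hone
    obtain ⟨hP, hE⟩ := dareSolution_spec hγ hone.posSemidef hR hK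
    have hpd := posDef_of_riccatiOp_eq hγ.le hone hR hP hE
    refine riccatiGain_ne_zero hγ hR hP fun h => ?_
    rw [Matrix.mul_one, Matrix.transpose_one, Matrix.one_mul] at h
    rw [Matrix.transpose_one, h] at hpd
    exact (Matrix.PosDef.isUnit hpd).ne_zero rfl

end Gain

end RegularizedLQR
-- Assembly of the main theorem.
theorem mainTheorem3 {n m : ℕ} (A : Matrix (Fin n) (Fin n) ℝ) (B : Matrix (Fin n) (Fin m) ℝ)
    (Q : Matrix (Fin n) (Fin n) ℝ) (γ : ℝ) (hγ₀ : 0 < γ) (hγ₁ : γ < 1)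
    (hQ : Q.PosSemidef) (hAB : IsStabilizable A B) (hAQ : IsDetectable A (CFC.sqrt Q))
    (hB : B.rank = m) :
    -- the Riccati equation and the optimality of the gain, for each of the three regularizers
    (∀ (r : Regularizer) (lam : ℝ) (Sw : Matrix (Fin n) (Fin n) ℝ), 0 < lam → Sw.PosDef →
      (∃! P : Matrix (Fin n) (Fin n) ℝ,
        P.PosSemidef ∧ SolvesDARE γ A B Q (r.penalty lam B Sw) P) ∧
      (Q.PosDef → (dareSolution γ A B Q (r.penalty lam B Sw)).PosDef) ∧
      ∀ (Ω : Type*) [MeasurableSpace Ω] (Pr : Measure Ω) [IsProbabilityMeasure Pr]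
        (S₀ : Matrix (Fin n) (Fin n) ℝ) (x₀ : Ω → Euc n) (w : ℕ → Ω → Euc n),
        S₀.PosSemidef → IsGaussianModel Pr S₀ Sw x₀ w →
        regularizedCost Pr x₀ w r lam γ A B Q Sw (r.gain lam γ A B Q Sw) < ⊤ ∧
        ∀ F : Matrix (Fin m) (Fin n) ℝ, F ≠ r.gain lam γ A B Q Sw →
          regularizedCost Pr x₀ w r lam γ A B Q Sw (r.gain lam γ A B Q Sw) <
            regularizedCost Pr x₀ w r lam γ A B Q Sw F) ∧
    -- the WKL gain does not depend on the noise covariance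
    (∀ (lam lam' : ℝ) (Sw Sw' : Matrix (Fin n) (Fin n) ℝ),
      Regularizer.WKL.gain lam γ A B Q Sw = Regularizer.WKL.gain lam' γ A B Q Sw') ∧
    -- low noise: KW approaches WKL
    Tendsto (fun ρ : ℝ => Regularizer.KW.gain 1 γ A B Q (ρ • 1)) (𝓝[>] 0)
      (𝓝 (Regularizer.WKL.gain 1 γ A B Q 1)) ∧
    -- high noise: KW approaches KL
    Tendsto (fun ρ : ℝ => Regularizer.KW.gain 1 γ A B Q (ρ • 1) -
      Regularizer.KL.gain 1 γ A B Q (ρ • 1)) atTop (𝓝 0) ∧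
    -- low noise: the KL gain vanishes if `√γ A` is Schur stable
    (specRadius A < ENNReal.ofReal (1 / √γ) →
      Tendsto (fun ρ : ℝ => Regularizer.KL.gain 1 γ A B Q (ρ • 1)) (𝓝[>] 0) (𝓝 0)) ∧
    -- whereas the WKL gain, the low noise limit of the KW gain, is nonzero in general
    (∃ (n' m' : ℕ) (A' : Matrix (Fin n') (Fin n') ℝ) (B' : Matrix (Fin n') (Fin m') ℝ)
      (Q' : Matrix (Fin n') (Fin n') ℝ),
      Q'.PosDef ∧ IsStabilizable A' B' ∧ IsDetectable A' (CFC.sqrt Q') ∧ B'.rank = m' ∧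
      specRadius A' < ENNReal.ofReal (1 / √γ) ∧
      Regularizer.WKL.gain 1 γ A' B' Q' 1 ≠ 0) := by
  have hC := transpose_sqrt_mul_sqrt hQ
  obtain ⟨K, hK⟩ := exists_lyapunovStable_of_stabilizable hγ₁.le hAB
  obtain ⟨L, hL⟩ := exists_lyapunovStable_of_detectable hγ₁.le hAQ
  have hR : (Bᵀ * B).PosDef := by simpa using posDef_conj_of_rank hB .one
  have hspec := fun (s : ℝ) (hs : 0 < s) =>
    dareSolution_spec (A := A) (B := B) hγ₀ hQ (hR.smul hs) hK
  have hP := fun s hs => (hspec s hs).1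
  have hE := fun s hs => (hspec s hs).2
  -- Independence of the noise is `rfl` because the WKL penalty `BᵀB` involves neither `Sw` nor
  -- `lam`.
  refine ⟨fun r lam Sw hlam hSw => ?_, fun _ _ _ _ => rfl, ?_, ?_, fun hA => ?_,
    exists_gain_WKL_ne_zero hγ₀ hγ₁⟩
  · have hRr := posDef_regularizer_penalty r hlam hSw hB
    obtain ⟨hPr, hEr⟩ := dareSolution_spec (A := A) (B := B) hγ₀ hQ hRr hK
    refine ⟨existsUnique_solvesDARE hγ₀ hQ hRr hK hC hL,
      fun hQ' => posDef_of_riccatiOp_eq hγ₀.le hQ' hRr hPr hEr, ?_⟩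
    intro Ω _ Pr _ S₀ x₀ w _ h
    exact regularizedCost_riccatiGain_lt h r hlam hSw hB hγ₀ hγ₁ hQ hC hL hPr hEr
  · rw [gain_WKL]
    refine (tendsto_gain_one hγ₀.le hR hC hL hP hE).congr' ?_
    filter_upwards [self_mem_nhdsWithin] with ρ hρ
    rw [gain_KW_smul_one (by linarith [Set.mem_Ioi.1 hρ])]
  · refine (tendsto_gain_sub_zero hγ₀.le hR hC hL hP hE).congr' ?_
    filter_upwards [eventually_gt_atTop 0] with ρ hρ
    rw [gain_KW_smul_one (by linarith), gain_KL_smul_one 1 hρ.ne']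
  · have hA' : LyapunovStable γ A := lyapunovStable_of_sqrt_smul hγ₀.le
      (lyapunovStable_of_tendsto_pow (tendsto_pow_of_specRadius_lt (Real.sqrt_pos.2 hγ₀) hA))
    refine (tendsto_gain_zero hγ₀.le hR hA' hQ hP hE).congr' ?_
    filter_upwards [self_mem_nhdsWithin] with ρ hρ
    rw [gain_KL_smul_one 1 (Set.mem_Ioi.1 hρ).ne']
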